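/- Let $\mathbb{K}$ be an arbitrary field, let $k \ge 2$ and $n_1,\dots,n_k \in \mathbb{N}$. For $T \in \mathbb{K}^{n_1}\otimes\cdots\otimes\mathbb{K}^{n_k}$ and $S \in \mathbb{K}^{m_1}\otimes\cdots\otimes\mathbb{K}^{m_k}$, the Kronecker product $T \boxtimes S \in \mathbb{K}^{n_1m_1}\otimes\cdots\otimes\mathbb{K}^{n_km_k}$ is the $k$-tensor whose coefficients in the standard basis are the pairwise products of the coefficients of $T$ and of $S$, and $T^{\boxtimes N} \in \mathbb{K}^{n_1^N}\otimes\cdots\otimes\mathbb{K}^{n_k^N}$ is the $N$-th power with respect to $\boxtimes$ (with $T^{\boxtimes 0} = 1\otimes\cdots\otimes 1 \in \mathbb{K}^{1}\otimes\cdots\otimes\mathbb{K}^{1}$). For $I \subseteq [k] = \{1,\dots,k\}$, the $I$-flattening of $T$ is the linear map $T_I : \bigotimes_{i\in I}(\mathbb{K}^{n_i})^* \to \bigotimes_{j\notin I}\mathbb{K}^{n_j}$ given by contraction with $T$. The tensor $T$ has partition rank one if $\operatorname{rk}(T_I)=1$ for some $I$ with $\emptyset \ne I \ne [k]$; the partition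 rank $\mathrm{PR}(T)$ is the smallest $r \in \mathbb{N}$ such that $T = S_1 + \cdots + S_r$ with each $S_i$ of partition rank one. Let $$c_k = \frac{k}{(k-1)^{(k-1)/k}}.$$ **Theorem (partition rank gap).** For every nonzero $T \in \mathbb{K}^{n_1}\otimes\cdots\otimes\mathbb{K}^{n_k}$, exactly one of the following is true: (a) $\mathrm{PR}(T^{\boxtimes N}) = 1$ for all $N \in \mathbb{N}$; (b) $\mathrm{PR}(T^{\boxtimes N}) \ge c_k^{\,N-o(N)}$ for all $N \in \mathbb{N}$, i.e. there is a function $\alpha : \mathbb{N} \to \mathbb{R}$ with $\alpha(N)/N \to 0$ as $N \to \infty$ and $\mathrm{PR}(T^{\boxtimes N}) \ge c_k^{\,N-\alpha(N)}$ for all $N \in \mathbb{N}$. -/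

import Mathlib

open scoped TensorProduct

noncomputable section

namespace PartitionRankGap

/-- The space `K^{n₁} ⊗ ⋯ ⊗ K^{n_k}` of `k`-tensors of format `n = (n₁, …, n_k)`. -/
abbrev Tensor (K : Type*) [Field K] {k : ℕ} (n : Fin k → ℕ) : Type _ :=
  ⨂[K] i, (Fin (n i) → K)

variable {K : Type*} [Field K] {k : ℕ}

/-- The basis `e_{a₁} ⊗ ⋯ ⊗ e_{a_k}` of `K^{n₁} ⊗ ⋯ ⊗ K^{n_k}`. -/
def stdBasis (K : Type*) [Field K] {k : ℕ} (n : Fin k → ℕ) :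
    Module.Basis (∀ i, Fin (n i)) K (Tensor K n) :=
  Basis.piTensorProduct fun i => Pi.basisFun K (Fin (n i))

/-- The identification of `k`-tensors with `k`-dimensional arrays: `coeff T a` is the coefficient
of `T` at `e_{a₁} ⊗ ⋯ ⊗ e_{a_k}`. -/
def coeff {n : Fin k → ℕ} : Tensor K n ≃ₗ[K] ((∀ i, Fin (n i)) → K) :=
  (stdBasis K n).equivFun

/-- The Kronecker product `T ⊠ S ∈ K^{n₁m₁} ⊗ ⋯ ⊗ K^{n_km_k}`, whose coefficients are the pairwise
products of the coefficients of `T` and of `S`; the index set `Fin (n i * m i)` is identified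
with `Fin (n i) × Fin (m i)` by `finProdFinEquiv`. -/
def kron {n m : Fin k → ℕ} (T : Tensor K n) (S : Tensor K m) :
    Tensor K (fun i => n i * m i) :=
  coeff.symm fun c =>
    coeff T (fun i => (finProdFinEquiv.symm (c i)).1) *
      coeff S (fun i => (finProdFinEquiv.symm (c i)).2)

/-- The Kronecker power `T^{⊠N} ∈ K^{n₁^N} ⊗ ⋯ ⊗ K^{n_k^N}`; the zeroth power is the unit
`1 ⊗ ⋯ ⊗ 1 ∈ K^1 ⊗ ⋯ ⊗ K^1`. -/
def kronPow {n : Fin k → ℕ} (T : Tensor K n) : (N : ℕ) → Tensor K (fun i => n i ^ N)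
  | 0 => coeff.symm fun _ => 1
  | N + 1 => kron (kronPow T N) T

/-- The `I`-flattening of `T`, as the matrix, in the standard bases, of the map
`⨂_{i ∈ I} (K^{n_i})^* → ⨂_{j ∉ I} K^{n_j}` given by contraction with `T`
(rows are indexed by the factors in `I`, columns by those outside `I`). -/
def flattening {n : Fin k → ℕ} (T : Tensor K n) (I : Finset (Fin k)) :
    Matrix (∀ i : {i // i ∈ I}, Fin (n i)) (∀ j : {j // j ∉ I}, Fin (n j)) K :=
  Matrix.of fun a b => coeff T fun i => if h : i ∈ I then a ⟨i, h⟩ else b ⟨i, h⟩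

/-- `T` has partition rank one: for some `∅ ≠ I ⊊ [k]` the `I`-flattening of `T` has rank one. -/
def HasPartitionRankOne {n : Fin k → ℕ} (T : Tensor K n) : Prop :=
  ∃ I : Finset (Fin k), I ≠ ∅ ∧ I ≠ Finset.univ ∧ (flattening T I).rank = 1

/-- The partition rank: the least `r` such that `T = S₁ + ⋯ + S_r` with each `S_j` of partition
rank one. (For `k ≥ 2` such an `r` always exists.) -/
def partitionRank {n : Fin k → ℕ} (T : Tensor K n) : ℕ :=
  sInf {r : ℕ | ∃ S : Fin r → Tensor K n, (∀ j, HasPartitionRankOne (S j)) ∧ T = ∑ j, S j}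

/-- The constant `c_k = k / (k - 1)^{(k - 1) / k}`. -/
def gapConst (k : ℕ) : ℝ :=
  (k : ℝ) / ((k : ℝ) - 1) ^ (((k : ℝ) - 1) / (k : ℝ))

end PartitionRankGap

end

/-! If the coefficient array of `T` factors along a proper nonempty set of slots, so do all
Kronecker powers, and (a) holds. Otherwise (b) holds, for the following reason.

Over an infinite extension field, a multilinear form that does not factor has a zero `v` at which
every partial differential is nonzero (`exists_smooth_zero`). Choose `w i` so that replacing `v i`
by `w i` gives the value 1. For `N = k * m`, restrict slot `i` of the `N`-th power to the product
vectors with `w i` in the positions of an `m`-set `A i` and `v i` elsewhere. A family that is not a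
partition leaves a position uncovered, which contributes the factor 0; a partition gives 1. So the
power restricts to the indicator tensor of the partitions of `N` points into `k` sets of size `m`.

It remains to bound the partition rank of that tensor below by a constant times `(k * m).choose m`,
which is `c_k ^ N` up to polynomial factors. This is an induction on the number of slots, for direct
sums of slightly thinned partition tensors (`IsPartitionSum.exists_lt_of_hasPartitionRankLE`). Given
a decomposition into `r` summands, contracting slot 0 with a vector orthogonal to at most `r`
functionals leaves at most `r` summands. If `r` is small, elimination (`exists_echelon`) yields for
most `m`-sets `C` an orthogonal vector equal to the basis vector of `C` plus entries that are small
or belong to earlier sets. Binary weights of the blocks of a partition have a fixed sum, so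
rescaling basis vectors by powers of a parameter also makes the earlier entries small. Modulo the
maximal ideal, contraction then gives the partition tensor on the complement of `C`. For a dispersed
family of sets `C` (`exists_dispersed`), few sets are disjoint from two members; deleting those
gives a direct sum whose total size is still comparable to the original one, with the same `r`. With
one slot left nothing can split, although the tensor is nonzero. -/

namespace PartitionRankGap

/-! ### Split functions and partition rank bounds for arrays -/

section Splitting

variable {R : Type*} [CommRing R] {k : ℕ} {ι : Fin k → Type*}

/-- `f` is the product of a function of the coordinates in `I` and a function of the remaining
coordinates, for some `∅ ≠ I ≠ [k]`. -/
def Splits (f : (∀ i, ι i) → R) : Prop :=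
  ∃ I : Set (Fin k), I.Nonempty ∧ Iᶜ.Nonempty ∧ ∃ g h : (∀ i, ι i) → R,
    DependsOn g I ∧ DependsOn h Iᶜ ∧ f = g * h

/-- `f` is a sum of `r` functions each of which vanishes or splits. -/
def HasPartitionRankLE (r : ℕ) (f : (∀ i, ι i) → R) : Prop :=
  ∃ S : Fin r → (∀ i, ι i) → R, (∀ l, S l = 0 ∨ Splits (S l)) ∧ f = ∑ l, S l

theorem Splits.map {R' : Type*} [CommRing R'] (σ : R →+* R') {f : (∀ i, ι i) → R}
    (hf : Splits f) : Splits fun a => σ (f a) := by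
  obtain ⟨I, h1, h2, g, h, hg, hh, rfl⟩ := hf
  refine ⟨I, h1, h2, fun a => σ (g a), fun a => σ (h a), fun x y e => ?_, fun x y e => ?_, ?_⟩
  · simp only [hg e]
  · simp only [hh e]
  · ext a; simp

theorem HasPartitionRankLE.map {R' : Type*} [CommRing R'] (σ : R →+* R') {r : ℕ}
    {f : (∀ i, ι i) → R} (hf : HasPartitionRankLE r f) :
    HasPartitionRankLE r fun a => σ (f a) := by
  obtain ⟨S, hS, rfl⟩ := hf
  refine ⟨fun l a => σ (S l a), fun l => ?_, ?_⟩
  · rcases hS l with h | h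
    · left; ext a; simp [h]
    · exact Or.inr (h.map σ)
  · ext a; simp [Finset.sum_apply]

/-- Linear substitutions in the separate coordinates preserve splitting. -/
theorem Splits.pullback [∀ i, Fintype (ι i)] [∀ i, Nonempty (ι i)] {κ : Fin k → Type*}
    [∀ i, Nonempty (κ i)] (M : ∀ i, κ i → ι i → R)
    {f : (∀ i, ι i) → R} (hf : Splits f) :
    Splits fun A : ∀ i, κ i => ∑ a, f a * ∏ i, M i (A i) (a i) := by
  classical
  obtain ⟨I, h1, h2, g, h, hg, hh, rfl⟩ := hf
  let a₀ : ∀ i, ι i := fun i => Classical.arbitrary _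
  let x₀ : ∀ i : {i // i ∈ I}, ι i := fun i => a₀ i
  let y₀ : ∀ i : {i // i ∉ I}, ι i := fun i => a₀ i
  let e := Equiv.piEquivPiSubtypeProd (fun i => i ∈ I) ι
  refine ⟨I, h1, h2,
    fun A => ∑ x : ∀ i : {i // i ∈ I}, ι i, g (e.symm (x, y₀)) *
      ∏ i : {i // i ∈ I}, M i (A i) (x i),
    fun A => ∑ y : ∀ i : {i // i ∉ I}, ι i, h (e.symm (x₀, y)) *
      ∏ i : {i // i ∉ I}, M i (A i) (y i),
    fun A B hAB => ?_, fun A B hAB => ?_, ?_⟩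
  · refine Finset.sum_congr rfl fun x _ => ?_
    congr 1
    exact Finset.prod_congr rfl fun i _ => by rw [hAB i i.2]
  · refine Finset.sum_congr rfl fun x _ => ?_
    congr 1
    exact Finset.prod_congr rfl fun i _ => by rw [hAB i i.2]
  · ext A
    rw [Pi.mul_apply, Fintype.sum_mul_sum, ← Fintype.sum_prod_type', ← e.symm.sum_comp]
    refine Finset.sum_congr rfl fun p _ => ?_
    obtain ⟨x, y⟩ := p
    have e1 : g (e.symm (x, y)) = g (e.symm (x, y₀)) := hg fun i hi => by
      simp [e, Equiv.piEquivPiSubtypeProd, hi]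
    have e2 : h (e.symm (x, y)) = h (e.symm (x₀, y)) := hh fun i hi => by
      have : i ∉ I := hi
      simp [e, Equiv.piEquivPiSubtypeProd, this]
    rw [Pi.mul_apply, e1, e2, ← Fintype.prod_subtype_mul_prod_subtype (fun i => i ∈ I)]
    have e3 : ∀ i : {i // i ∈ I}, e.symm (x, y) i = x i := fun i => by
      simp [e, Equiv.piEquivPiSubtypeProd, i.2]
    have e4 : ∀ i : {i // i ∉ I}, e.symm (x, y) i = y i := fun i => by
      simp [e, Equiv.piEquivPiSubtypeProd, i.2]
    simp only [e3, e4]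
    ring

theorem HasPartitionRankLE.pullback [∀ i, Fintype (ι i)] [∀ i, Nonempty (ι i)]
    {κ : Fin k → Type*} [∀ i, Nonempty (κ i)] (M : ∀ i, κ i → ι i → R) {r : ℕ}
    {f : (∀ i, ι i) → R} (hf : HasPartitionRankLE r f) :
    HasPartitionRankLE r fun A : ∀ i, κ i => ∑ a, f a * ∏ i, M i (A i) (a i) := by
  obtain ⟨S, hS, rfl⟩ := hf
  refine ⟨fun l A => ∑ a, S l a * ∏ i, M i (A i) (a i), fun l => ?_, ?_⟩
  · rcases hS l with h | h
    · left; ext a; simp [h]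
    · exact Or.inr (h.pullback M)
  · ext a
    simp only [Finset.sum_apply, Finset.sum_mul]
    exact Finset.sum_comm

/-- Rescaling the basis vectors of each slot separately is harmless; this is what permits the
degeneration by powers of a parameter. -/
theorem HasPartitionRankLE.mul_prod {r : ℕ} {f : (∀ i, ι i) → R}
    (hf : HasPartitionRankLE r f) (s : ∀ i, ι i → R) :
    HasPartitionRankLE r fun a => (∏ i, s i (a i)) * f a := by
  classical
  obtain ⟨S, hS, rfl⟩ := hf
  refine ⟨fun l a => (∏ i, s i (a i)) * S l a, fun l => ?_, ?_⟩
  · rcases hS l with h | ⟨I, h1, h2, g, h, hg, hh, e⟩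
    · left; ext a; simp [h]
    · refine Or.inr ⟨I, h1, h2, fun a => (∏ i : {i // i ∈ I}, s i (a i)) * g a,
        fun a => (∏ i : {i // i ∉ I}, s i (a i)) * h a, fun x y hxy => ?_, fun x y hxy => ?_, ?_⟩
      · simp only [hg hxy]
        congr 1
        exact Finset.prod_congr rfl fun i _ => by rw [hxy i i.2]
      · simp only [hh hxy]
        congr 1
        exact Finset.prod_congr rfl fun i _ => by rw [hxy i i.2]
      · ext a
        dsimp only
        rw [e, Pi.mul_apply, Pi.mul_apply,
          ← Fintype.prod_subtype_mul_prod_subtype (fun i => i ∈ I)]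
        ring
  · ext a
    simp only [Finset.sum_apply, Finset.mul_sum]

/-- One coordinate has no proper nonempty subset, so no summand can split. This is where the
induction on the number of slots ends. -/
theorem HasPartitionRankLE.eq_zero {r : ℕ} {ι : Fin 1 → Type*} {f : (∀ i, ι i) → R}
    (hf : HasPartitionRankLE r f) : f = 0 := by
  obtain ⟨S, hS, rfl⟩ := hf
  refine Finset.sum_eq_zero fun l _ => ?_
  rcases hS l with h | ⟨I, ⟨i, hi⟩, ⟨j, hj⟩, -⟩
  · exact h
  · exact absurd (Subsingleton.elim i j ▸ hi) hj

end Splitting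

/-! ### Contracting one slot -/

section Contraction

variable {R : Type*} [CommRing R] {k : ℕ} {β : Type*} [Fintype β] [Nonempty β]

/-- Contraction of the coordinate `0` with a vector orthogonal to a suitable `φ` turns a function
that splits into one that vanishes or splits. -/
theorem Splits.contract {f : (Fin (k + 1) → β) → R} (hf : Splits f) :
    ∃ φ : β → R, ∀ u : β → R, ∑ C, u C * φ C = 0 →
      (fun A : Fin k → β => ∑ C, u C * f (Fin.cons C A)) = 0 ∨
        Splits fun A : Fin k → β => ∑ C, u C * f (Fin.cons C A) := by
  obtain ⟨I, h1, h2, g, h, hg, hh, rfl⟩ := hf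
  wlog h0 : (0 : Fin (k + 1)) ∈ I generalizing I g h
  · have := this Iᶜ h2 (by rwa [compl_compl]) h g hh (by rwa [compl_compl]) h0
    rwa [mul_comm h g] at this
  let C₀ : β := Classical.arbitrary _
  have hh' : ∀ C A, h (Fin.cons C A) = h (Fin.cons C₀ A) := fun C A => hh fun i hi => by
    refine Fin.cases (fun hi => absurd h0 hi) (fun i _ => ?_) i hi
    simp
  -- Only a factor in coordinate 0 alone imposes a condition on `u`. In the other case the
  -- contraction takes place inside `g` and the product still splits, so `φ = 0` will do.
  by_cases hI : I = {0}
  · refine ⟨fun C => g fun _ => C, fun u hu => Or.inl ?_⟩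
    ext A
    have : ∀ C, g (Fin.cons C A) = g fun _ => C := fun C => hg fun i hi => by
      rw [hI] at hi
      rw [Set.mem_singleton_iff.1 hi]
      rfl
    calc _ = (∑ C, u C * g fun _ => C) * h (Fin.cons C₀ A) := by
          rw [Finset.sum_mul]
          refine Finset.sum_congr rfl fun C _ => ?_
          rw [Pi.mul_apply, this, hh']
          ring
      _ = _ := by rw [hu]; simp
  · refine ⟨0, fun u _ => Or.inr ⟨{i | i.succ ∈ I}, ?_, ?_,
      fun A => ∑ C, u C * g (Fin.cons C A), fun A => h (Fin.cons C₀ A),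
      fun x y e => ?_, fun x y e => ?_, ?_⟩⟩
    · obtain ⟨i, hi, hi0⟩ : ∃ i ∈ I, i ≠ 0 := by
        by_contra! hcon
        exact hI (Set.eq_singleton_iff_unique_mem.2 ⟨h0, hcon⟩)
      obtain ⟨j, rfl⟩ := Fin.exists_succ_eq.2 hi0
      exact ⟨j, hi⟩
    · obtain ⟨i, hi⟩ := h2
      have hi0 : i ≠ 0 := fun h => hi (h ▸ h0)
      obtain ⟨j, rfl⟩ := Fin.exists_succ_eq.2 hi0
      exact ⟨j, hi⟩
    · refine Finset.sum_congr rfl fun C _ => ?_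
      congr 1
      refine hg fun i hi => ?_
      refine Fin.cases (fun _ => rfl) (fun i hi => ?_) i hi
      simpa using e i hi
    · refine hh fun i hi => ?_
      refine Fin.cases (fun _ => rfl) (fun i hi => ?_) i hi
      simpa using e i hi
    · ext A
      rw [Pi.mul_apply, Finset.sum_mul]
      refine Finset.sum_congr rfl fun C _ => ?_
      rw [Pi.mul_apply, hh' C]
      ring

/-- Each summand costs one linear condition on `u`, and the number of summands does not grow. -/
theorem HasPartitionRankLE.contract {r : ℕ} {f : (Fin (k + 1) → β) → R}
    (hf : HasPartitionRankLE r f) :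
    ∃ φ : Fin r → β → R, ∀ u : β → R, (∀ l, ∑ C, u C * φ l C = 0) →
      HasPartitionRankLE r fun A : Fin k → β => ∑ C, u C * f (Fin.cons C A) := by
  obtain ⟨S, hS, rfl⟩ := hf
  have : ∀ l, ∃ φ : β → R, ∀ u : β → R, ∑ C, u C * φ C = 0 →
      (fun A : Fin k → β => ∑ C, u C * S l (Fin.cons C A)) = 0 ∨
        Splits fun A : Fin k → β => ∑ C, u C * S l (Fin.cons C A) := fun l => by
    rcases hS l with h | h
    · refine ⟨0, fun u _ => Or.inl ?_⟩
      ext A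
      simp [h]
    · exact h.contract
  choose φ hφ using this
  refine ⟨φ, fun u hu => ⟨_, fun l => hφ l u (hu l), ?_⟩⟩
  ext A
  simp only [Finset.sum_apply, Finset.mul_sum]
  exact Finset.sum_comm

end Contraction

/-! ### Gaussian elimination over a valued field -/

section Elimination

variable {E Γ : Type*} [Field E] [LinearOrderedCommGroupWithZero Γ] (v : Valuation E Γ)

/-- Gaussian elimination over a valued field: the common kernel in `E^F` of finitely many
functionals contains vectors `u C`, `C ∈ S`, in echelon form with integral entries, which modulo
the maximal ideal involve only indices that come before `C`; the set `S` misses at most as many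
elements of `F` as there are functionals. -/
theorem exists_echelon {β Λ : Type*} [Fintype β] [DecidableEq β] (b : β → ℤ)
    (hb : Function.Injective b) (φ : Λ → β → E) (F : Finset β) (L : Finset Λ) :
    ∃ S ⊆ F, (F \ S).card ≤ L.card ∧ ∃ u : β → β → E,
      (∀ C ∈ S, u C C = 1) ∧ (∀ C ∈ S, ∀ C', C' ∉ F → u C C' = 0) ∧
      (∀ C ∈ S, ∀ C' ∈ S, C' ≠ C → u C C' = 0) ∧
      (∀ C ∈ S, ∀ C', v (u C C') ≤ 1) ∧
      (∀ C ∈ S, ∀ C', C' ≠ C → v (u C C') < 1 ∨ b C' < b C) ∧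
      ∀ C ∈ S, ∀ l ∈ L, ∑ C', u C C' * φ l C' = 0 := by
  classical
  induction L using Finset.induction_on with
  | empty =>
    refine ⟨F, subset_rfl, by simp, fun C C' => if C' = C then 1 else 0, ?_, ?_, ?_, ?_, ?_, ?_⟩
    · simp
    · intro C hC C' hC'
      exact if_neg fun h : C' = C => hC' (h ▸ hC)
    · intro C _ C' _ h
      exact if_neg h
    · intro C _ C'
      dsimp only
      split_ifs <;> simp
    · intro C _ C' h
      simp [h]
    · simp
  | insert l L hl ih =>
    obtain ⟨S, hSF, hcard, u, h1, h2, h3, h4, h5, h6⟩ := ih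
    set ψ : β → E := fun C => ∑ C', u C C' * φ l C' with hψ
    by_cases hall : ∀ C ∈ S, ψ C = 0
    · refine ⟨S, hSF, hcard.trans (Finset.card_le_card (Finset.subset_insert _ _)), u, h1, h2, h3,
        h4, h5, fun C hC l' hl' => ?_⟩
      rcases Finset.mem_insert.1 hl' with rfl | hl'
      · exact hall C hC
      · exact h6 C hC l' hl'
    push Not at hall
    obtain ⟨C₁, hC₁, hne₁⟩ := hall
    -- The pivot `C₀` has maximal `v (ψ C)`, so that the ratios `ρ` are integral; among ties it
    -- comes first in the order `b`, so that `ρ C` is a unit only for later `C` and the echelon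
    -- shape survives.
    obtain ⟨C₂, hC₂, hmax⟩ := S.exists_max_image (fun C => v (ψ C)) ⟨C₁, hC₁⟩
    obtain ⟨C₀, hC₀, hmin⟩ := (S.filter fun C => v (ψ C) = v (ψ C₂)).exists_min_image b
      ⟨C₂, by simp [hC₂]⟩
    obtain ⟨hC₀S, hC₀v⟩ := Finset.mem_filter.1 hC₀
    have hpos : 0 < v (ψ C₀) := by
      rw [hC₀v]
      exact lt_of_lt_of_le (by simpa [zero_lt_iff] using hne₁) (hmax C₁ hC₁)
    have hψ₀ : ψ C₀ ≠ 0 := by simpa [zero_lt_iff] using hpos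
    set ρ : β → E := fun C => ψ C / ψ C₀ with hρ
    have hρ1 : ∀ C ∈ S, v (ρ C) ≤ 1 := fun C hC => by
      rw [hρ]
      simp only [map_div₀]
      exact (div_le_one₀ hpos).2 (hC₀v ▸ hmax C hC)
    have hρ2 : ∀ C ∈ S, C ≠ C₀ → v (ρ C) < 1 ∨ b C₀ < b C := fun C hC hne => by
      rcases (hρ1 C hC).lt_or_eq with h | h
      · exact Or.inl h
      · right
        have h' : v (ψ C) = v (ψ C₀) := by
          simp only [hρ, map_div₀] at h
          exact (div_eq_one_iff_eq hpos.ne').1 h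
        refine lt_of_le_of_ne (hmin C (Finset.mem_filter.2 ⟨hC, h'.trans hC₀v⟩)) fun h => ?_
        exact hne (hb h).symm
    refine ⟨S.erase C₀, (Finset.erase_subset _ _).trans hSF, ?_,
      fun C C' => u C C' - ρ C * u C₀ C', ?_, ?_, ?_, ?_, ?_, ?_⟩
    · rw [Finset.card_insert_of_notMem hl]
      have : F \ S.erase C₀ ⊆ insert C₀ (F \ S) := fun x hx => by
        simp only [Finset.mem_sdiff, Finset.mem_erase, Finset.mem_insert] at hx ⊢
        tauto
      exact (Finset.card_le_card this).trans ((Finset.card_insert_le _ _).trans (by omega))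
    · intro C hC
      obtain ⟨hne, hC⟩ := Finset.mem_erase.1 hC
      simp [h1 C hC, h3 C₀ hC₀S C hC hne]
    · intro C hC C' hC'
      obtain ⟨hne, hC⟩ := Finset.mem_erase.1 hC
      simp [h2 C hC C' hC', h2 C₀ hC₀S C' hC']
    · intro C hC C' hC' hCC'
      obtain ⟨hne, hC⟩ := Finset.mem_erase.1 hC
      obtain ⟨hne', hC'⟩ := Finset.mem_erase.1 hC'
      simp [h3 C hC C' hC' hCC', h3 C₀ hC₀S C' hC' hne']
    · intro C hC C'
      obtain ⟨hne, hC⟩ := Finset.mem_erase.1 hC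
      refine v.map_sub_le (h4 C hC C') ?_
      rw [map_mul]
      exact mul_le_one' (hρ1 C hC) (h4 C₀ hC₀S C')
    · intro C hC C' hCC'
      obtain ⟨hne, hC⟩ := Finset.mem_erase.1 hC
      rcases lt_or_ge (b C') (b C) with hlt | hge
      · exact Or.inr hlt
      refine Or.inl (v.map_sub_lt ((h5 C hC C' hCC').resolve_right hge.not_gt) ?_)
      rw [map_mul]
      rcases hρ2 C hC hne with h | h
      · exact mul_lt_one_of_nonneg_of_lt_one_left zero_le h (h4 C₀ hC₀S C')
      · have hne' : C' ≠ C₀ := fun e => absurd hge (e ▸ h).not_ge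
        exact mul_lt_one_of_nonneg_of_lt_one_right (hρ1 C hC) zero_le
          ((h5 C₀ hC₀S C' hne').resolve_right fun h' => absurd (h'.trans h) hge.not_gt)
    · intro C hC l' hl'
      obtain ⟨hne, hC⟩ := Finset.mem_erase.1 hC
      have key : ∀ l', ∑ C', (u C C' - ρ C * u C₀ C') * φ l' C' =
          ∑ C', u C C' * φ l' C' - ρ C * ∑ C', u C₀ C' * φ l' C' := fun l' => by
        rw [Finset.mul_sum, ← Finset.sum_sub_distrib]
        exact Finset.sum_congr rfl fun _ _ => by ring
      rw [key]
      rcases Finset.mem_insert.1 hl' with rfl | hl'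
      · change ψ C - ψ C / ψ C₀ * ψ C₀ = 0
        rw [div_mul_cancel₀ _ hψ₀, sub_self]
      · rw [h6 C hC l' hl', h6 C₀ hC₀S l' hl', mul_zero, sub_zero]

end Elimination

/-! ### Dispersed families of sets -/

section Dispersed

/-- Greedy choice of a large subset of `G` with small pairwise interaction `w`. -/
theorem exists_subset_card_eq_sum_le {γ : Type*} [DecidableEq γ] (G : Finset γ) (hG : G.Nonempty)
    (w : γ → γ → ℝ) (hw : ∀ C C', w C C' = w C' C)
    (a : ℝ) (ha : ∀ C' ∈ G, ∑ C ∈ G, w C C' ≤ a * G.card) (y : ℕ)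
    (hw0 : ∀ C C', 0 ≤ w C C') (hy : ∀ C ∈ G, a * y < w C C) (n : ℕ) (hn : n ≤ y) :
    ∃ R ⊆ G, R.card = n + 1 ∧
      ∑ C ∈ R, ∑ C' ∈ R, (if C = C' then 0 else w C C') ≤ a * n * (n + 1) := by
  have hGpos : (0 : ℝ) < G.card := by exact_mod_cast hG.card_pos
  have ha0 : 0 ≤ a := by
    obtain ⟨C, hC⟩ := hG
    have : 0 ≤ a * G.card := (Finset.sum_nonneg fun _ _ => hw0 _ _).trans (ha C hC)
    exact nonneg_of_mul_nonneg_left this hGpos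
  induction n with
  | zero =>
    obtain ⟨C, hC⟩ := hG
    exact ⟨{C}, by simpa using hC, by simp, by simp⟩
  | succ n ih =>
    obtain ⟨R, hRG, hcard, hsum⟩ := ih (by omega)
    -- Averaging over `G`: each of the `n + 1` elements of `R` contributes at most `a` on average.
    obtain ⟨C, hC, hle⟩ : ∃ C ∈ G, ∑ C' ∈ R, w C C' ≤ a * (n + 1) := by
      by_contra! hcon
      have h1 : ∑ C ∈ G, a * ((n : ℝ) + 1) < ∑ C ∈ G, ∑ C' ∈ R, w C C' :=
        Finset.sum_lt_sum_of_nonempty hG hcon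
      rw [Finset.sum_comm] at h1
      have h2 : ∑ C' ∈ R, ∑ C ∈ G, w C C' ≤ ∑ C' ∈ R, a * G.card :=
        Finset.sum_le_sum fun C' hC' => ha C' (hRG hC')
      simp only [Finset.sum_const, nsmul_eq_mul, hcard] at h1 h2
      push_cast at h2
      nlinarith
    -- The diagonal entry `w C C` alone would exceed the bound on the sum.
    have hCR : C ∉ R := fun hCR => by
      have h1 : w C C ≤ ∑ C' ∈ R, w C C' :=
        Finset.single_le_sum (f := fun C' => w C C') (fun _ _ => hw0 _ _) hCR
      have h2 : a * (n + 1) ≤ a * y :=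
        mul_le_mul_of_nonneg_left (by exact_mod_cast hn) ha0
      linarith [hy C hC]
    refine ⟨insert C R, Finset.insert_subset hC hRG, by rw [Finset.card_insert_of_notMem hCR, hcard],
      ?_⟩
    have e1 : ∑ C' ∈ R, (if C = C' then 0 else w C C') = ∑ C' ∈ R, w C C' :=
      Finset.sum_congr rfl fun C' hC' => if_neg fun h : C = C' => hCR (h ▸ hC')
    have e2 : ∑ C' ∈ R, (if C' = C then 0 else w C' C) = ∑ C' ∈ R, w C C' :=
      Finset.sum_congr rfl fun C' hC' => by
        rw [if_neg fun h : C' = C => hCR (h ▸ hC'), hw]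
    simp only [Finset.sum_insert hCR, Finset.sum_add_distrib, e1, e2, if_true]
    push_cast
    nlinarith

/-- Markov's inequality applied to the greedy family of size `y + 1`: at most half of its members
have more than twice the average interaction with the others. -/
theorem exists_subset_sum_erase_le {γ : Type*} [DecidableEq γ] (G : Finset γ) (hG : G.Nonempty)
    (w : γ → γ → ℝ) (hw : ∀ C C', w C C' = w C' C)
    (a : ℝ) (ha : ∀ C' ∈ G, ∑ C ∈ G, w C C' ≤ a * G.card) (y : ℕ)
    (hw0 : ∀ C C', 0 ≤ w C C') (hy : ∀ C ∈ G, a * y < w C C) :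
    ∃ R ⊆ G, y + 1 ≤ 2 * R.card ∧ ∀ C ∈ R, ∑ C' ∈ R.erase C, w C C' ≤ 2 * (a * y) := by
  obtain ⟨R, hRG, hcard, hsum⟩ := exists_subset_card_eq_sum_le G hG w hw a ha y hw0 hy y le_rfl
  have hGpos : (0 : ℝ) < G.card := by exact_mod_cast hG.card_pos
  have ha0 : 0 ≤ a := by
    obtain ⟨C, hC⟩ := hG
    have : 0 ≤ a * G.card := (Finset.sum_nonneg fun _ _ => hw0 _ _).trans (ha C hC)
    exact nonneg_of_mul_nonneg_left this hGpos
  have hay : 0 ≤ a * y := by positivity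
  set s : γ → ℝ := fun C => ∑ C' ∈ R, (if C = C' then 0 else w C C') with hs
  have hs0 : ∀ C, 0 ≤ s C := fun C => Finset.sum_nonneg fun _ _ => by
    split_ifs
    exacts [le_rfl, hw0 _ _]
  set B := R.filter fun C => 2 * (a * y) < s C with hB
  have hsplit : B.card + (R.filter fun C => ¬ 2 * (a * y) < s C).card = R.card :=
    Finset.card_filter_add_card_filter_not _
  have hBsum : ∑ C ∈ B, s C ≤ a * y * (y + 1) :=
    (Finset.sum_le_sum_of_subset_of_nonneg (Finset.filter_subset _ _) fun _ _ _ => hs0 _).trans hsum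
  have hBcard : 2 * B.card ≤ y + 1 := by
    rcases B.eq_empty_or_nonempty with h | h
    · simp [h]
    have h1 : ∑ C ∈ B, 2 * (a * y) < ∑ C ∈ B, s C :=
      Finset.sum_lt_sum_of_nonempty h fun C hC => (Finset.mem_filter.1 hC).2
    simp only [Finset.sum_const, nsmul_eq_mul] at h1
    have h2 : (a * y) * (2 * B.card) < (a * y) * (y + 1) := by linarith
    have h3 : (2 * B.card : ℝ) < y + 1 := lt_of_mul_lt_mul_left h2 hay
    exact_mod_cast h3.le
  refine ⟨R.filter fun C => ¬ 2 * (a * y) < s C, (Finset.filter_subset _ _).trans hRG, by omega,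
    fun C hC => ?_⟩
  obtain ⟨hCR, hC⟩ := Finset.mem_filter.1 hC
  refine le_trans ?_ (not_lt.1 hC)
  calc _ ≤ ∑ C' ∈ R.erase C, w C C' :=
        Finset.sum_le_sum_of_subset_of_nonneg
          (Finset.erase_subset_erase _ (Finset.filter_subset _ _)) fun _ _ _ => hw0 _ _
    _ = ∑ C' ∈ R.erase C, (if C = C' then 0 else w C C') :=
        Finset.sum_congr rfl fun C' hC' => (if_neg (Finset.ne_of_mem_erase hC').symm).symm
    _ ≤ s C :=
        Finset.sum_le_sum_of_subset_of_nonneg (Finset.erase_subset _ _) fun _ _ _ => by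
          split_ifs
          exacts [le_rfl, hw0 _ _]

variable {α : Type*} [DecidableEq α]

theorem card_filter_disjoint {W C : Finset α} {m n : ℕ} (hW : W.card = n + m) (hC : C ⊆ W)
    (hCm : C.card = m) :
    ((W.powersetCard m).filter fun A => Disjoint A C).card = n.choose m := by
  have : (W.powersetCard m).filter (fun A => Disjoint A C) = (W \ C).powersetCard m := by
    ext A
    simp only [Finset.mem_filter, Finset.mem_powersetCard, Finset.subset_sdiff]
    tauto
  rw [this, Finset.card_powersetCard, Finset.card_sdiff_of_subset hC, hW, hCm, Nat.add_sub_cancel]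

/-- In a ground set `W` of size `n + m` there are many `m`-sets `C` outside a small set `B₀` such
that few `m`-sets `A` disjoint from one of them are disjoint from another one, or belong to one of
the small sets `B i`. -/
theorem exists_dispersed {j : ℕ} {δ' : ℝ} (hδ' : 0 < δ') (hδ'1 : δ' ≤ 1) {m n : ℕ} (hnm : m ≤ n)
    {W : Finset α} (hW : W.card = n + m) (B₀ : Finset (Finset α)) (B : Fin j → Finset (Finset α))
    (hB₀ : (B₀.card : ℝ) ≤ 1 / 4 * (n + m).choose m) (hB : ∀ i, B i ⊆ W.powersetCard m)
    (hBc : ∀ i, ((B i).card : ℝ) ≤ δ' / (8 * (j + 1)) * (n + m).choose m) :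
    ∃ R ⊆ W.powersetCard m \ B₀, δ' / 16 * ((n + m).choose m : ℝ) ≤ R.card * n.choose m ∧
      ∀ C ∈ R, ∀ i, (((W.powersetCard m).filter fun A => Disjoint A C ∧
        (A ∈ B i ∨ ∃ C' ∈ R, C' ≠ C ∧ Disjoint A C')).card : ℝ) ≤ δ' * n.choose m := by
  set P := W.powersetCard m with hP
  set D : ℝ := ((n + m).choose m : ℝ) with hD
  set d : ℝ := (n.choose m : ℝ) with hd
  have hDpos : 0 < D := by
    rw [hD]; exact_mod_cast Nat.choose_pos (Nat.le_add_left m n)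
  have hdpos : 0 < d := by rw [hd]; exact_mod_cast Nat.choose_pos hnm
  have hPcard : (P.card : ℝ) = D := by rw [hP, Finset.card_powersetCard, hW]
  have hdisj : ∀ C ∈ P, ((P.filter fun A => Disjoint A C).card : ℝ) = d := fun C hC => by
    obtain ⟨h1, h2⟩ := Finset.mem_powersetCard.1 hC
    rw [hP, card_filter_disjoint hW h1 h2]
  -- double counting
  have hdc : ∀ Q ⊆ P, ∑ C ∈ P, ((Q.filter fun A => Disjoint A C).card : ℝ) = Q.card * d := by
    intro Q hQ
    simp only [Finset.card_filter, Nat.cast_sum]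
    rw [Finset.sum_comm, ← nsmul_eq_mul, ← Finset.sum_const]
    refine Finset.sum_congr rfl fun A hA => ?_
    rw [← hdisj A (hQ hA), Finset.card_filter, Nat.cast_sum]
    exact Finset.sum_congr rfl fun C _ => by simp only [disjoint_comm]
  -- The bad `C`, for which `B i` contains more than a fraction `δ' / 2` of the sets disjoint from
  -- `C`. The other `δ' / 2` is reserved for overlaps within `R`.
  set T : Fin j → Finset (Finset α) := fun i =>
    P.filter fun C => δ' / 2 * d < ((B i).filter fun A => Disjoint A C).card with hT
  have hTc : ∀ i, ((T i).card : ℝ) * (j + 1) ≤ 1 / 4 * D := fun i => by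
    have h1 : ∑ C ∈ T i, δ' / 2 * d ≤ ∑ C ∈ P, (((B i).filter fun A => Disjoint A C).card : ℝ) :=
      (Finset.sum_le_sum fun C hC => (Finset.mem_filter.1 hC).2.le).trans
        (Finset.sum_le_sum_of_subset_of_nonneg (Finset.filter_subset _ _) fun _ _ _ => by positivity)
    rw [hdc _ (hB i), Finset.sum_const, nsmul_eq_mul] at h1
    have h2 : ((T i).card : ℝ) * (δ' / 2) ≤ δ' / (8 * (j + 1)) * D := by
      have : ((T i).card : ℝ) * (δ' / 2) * d ≤ (B i).card * d := by linarith
      exact (le_of_mul_le_mul_right this hdpos).trans (hBc i)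
    have h3 : δ' * (((T i).card : ℝ) * (j + 1)) ≤ δ' * (1 / 4 * D) := by
      have : δ' / (8 * (j + 1)) * D * (2 * (j + 1)) = δ' * (1 / 4 * D) := by
        field_simp
        norm_num
      rw [← this]
      have hj : (0 : ℝ) ≤ 2 * (j + 1) := by positivity
      nlinarith [mul_le_mul_of_nonneg_right h2 hj]
    exact le_of_mul_le_mul_left h3 hδ'
  set T' : Finset (Finset α) := Finset.univ.biUnion T with hT'
  have hT'c : (T'.card : ℝ) ≤ 1 / 4 * D := by
    have h1 : (T'.card : ℝ) ≤ ∑ i, ((T i).card : ℝ) := by exact_mod_cast Finset.card_biUnion_le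
    have h2 : ∑ i, ((T i).card : ℝ) * (j + 1) ≤ ∑ i : Fin j, 1 / 4 * D :=
      Finset.sum_le_sum fun i _ => hTc i
    rw [← Finset.sum_mul, Finset.sum_const, nsmul_eq_mul, Finset.card_univ, Fintype.card_fin] at h2
    have h3 : (∑ i, ((T i).card : ℝ)) * (j + 1) ≤ 1 / 4 * D * (j + 1) := by nlinarith
    exact h1.trans (le_of_mul_le_mul_right h3 (by positivity))
  set G := (P \ B₀) \ T' with hG
  have hGc : D / 2 ≤ G.card := by
    have h1 : P.card ≤ G.card + B₀.card + T'.card := by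
      have e1 := Finset.le_card_sdiff T' (P \ B₀)
      have e2 := Finset.le_card_sdiff B₀ P
      rw [hG]
      omega
    have h2 : (P.card : ℝ) ≤ G.card + B₀.card + T'.card := by exact_mod_cast h1
    linarith
  have hGP : G ⊆ P := Finset.sdiff_subset.trans Finset.sdiff_subset
  have hGne : G.Nonempty := by
    rw [← Finset.card_pos]
    have : (0 : ℝ) < G.card := by linarith
    exact_mod_cast this
  set w : Finset α → Finset α → ℝ := fun C C' =>
    ((P.filter fun A => Disjoint A C ∧ Disjoint A C').card : ℝ) with hw
  -- The average interaction is at most `a = 2 * d ^ 2 / D`, because `G` has at least `D / 2`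
  -- elements. This `y` makes the overlap `2 * (a * y)` at most `δ' / 2 * d`, while `R` keeps at
  -- least `(y + 1) / 2` elements.
  set y := ⌊δ' / 8 * D / d⌋₊ with hy
  have hyd : (y : ℝ) * d ≤ δ' / 8 * D :=
    (le_div_iff₀ hdpos).1 (Nat.floor_le (by positivity))
  have hyd' : δ' / 8 * D ≤ (y + 1 : ℝ) * d :=
    ((div_lt_iff₀ hdpos).1 (Nat.lt_floor_add_one _)).le
  have hay : 2 * d ^ 2 / D * y ≤ δ' / 4 * d := by
    have : 2 * d ^ 2 / D * y = 2 * d * (y * d) / D := by ring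
    rw [this, div_le_iff₀ hDpos]
    nlinarith
  obtain ⟨R, hRG, hRc, hR⟩ := exists_subset_sum_erase_le G hGne w
    (fun C C' => by simp only [hw, and_comm]) (2 * d ^ 2 / D)
    (fun C' hC' => by
      have h1 : ∑ C ∈ G, w C C' ≤ ∑ C ∈ P, w C C' :=
        Finset.sum_le_sum_of_subset_of_nonneg hGP fun _ _ _ => by positivity
      have h2 : ∑ C ∈ P, w C C' = d * d := by
        have h := hdc (P.filter fun A => Disjoint A C') (Finset.filter_subset _ _)
        rw [hdisj C' (hGP hC')] at h
        rw [← h]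
        refine Finset.sum_congr rfl fun C _ => ?_
        simp only [hw, Finset.filter_filter, and_comm]
      have h3 : d * d ≤ 2 * d ^ 2 / D * G.card := by
        rw [div_mul_eq_mul_div, le_div_iff₀ hDpos]
        nlinarith [sq_nonneg d]
      linarith)
    y (fun _ _ => by positivity)
    (fun C hC => by
      have : w C C = d := by simp only [hw, and_self, hdisj C (hGP hC)]
      rw [this]
      nlinarith)
  refine ⟨R, hRG.trans Finset.sdiff_subset, ?_, fun C hC i => ?_⟩
  · have : (y + 1 : ℝ) ≤ 2 * R.card := by exact_mod_cast hRc
    nlinarith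
  · have hCT : C ∉ T i := fun h =>
      (Finset.mem_sdiff.1 (hRG hC)).2 (Finset.mem_biUnion.2 ⟨i, Finset.mem_univ _, h⟩)
    have h1 : (((B i).filter fun A => Disjoint A C).card : ℝ) ≤ δ' / 2 * d := by
      by_contra! h
      exact hCT (Finset.mem_filter.2 ⟨hGP (hRG hC), h⟩)
    have hsub : (P.filter fun A => Disjoint A C ∧ (A ∈ B i ∨ ∃ C' ∈ R, C' ≠ C ∧ Disjoint A C')) ⊆
        ((B i).filter fun A => Disjoint A C) ∪
          (R.erase C).biUnion fun C' => P.filter fun A => Disjoint A C ∧ Disjoint A C' := by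
      intro A hA
      simp only [Finset.mem_filter, Finset.mem_union, Finset.mem_biUnion, Finset.mem_erase] at hA ⊢
      obtain ⟨hAP, hAC, h | ⟨C', h1, h2, h3⟩⟩ := hA
      · exact Or.inl ⟨h, hAC⟩
      · exact Or.inr ⟨C', ⟨h2, h1⟩, hAP, hAC, h3⟩
    have h2 := ((Finset.card_le_card hsub).trans (Finset.card_union_le _ _)).trans
      (Nat.add_le_add_left Finset.card_biUnion_le _)
    have h3 : ((P.filter fun A => Disjoint A C ∧
        (A ∈ B i ∨ ∃ C' ∈ R, C' ≠ C ∧ Disjoint A C')).card : ℝ) ≤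
        ((B i).filter fun A => Disjoint A C).card + ∑ C' ∈ R.erase C, w C C' := by
      simp only [hw]
      exact_mod_cast h2
    have h4 := hR C hC
    linarith

end Dispersed

/-! ### Partition tensors and their degeneration under contraction -/

section PartitionTensors

variable {E Γ : Type*} [Field E] [LinearOrderedCommGroupWithZero Γ]

/-- A one-parameter group of elements whose valuations lie arbitrarily close to `1`. -/
structure IsFineScaling (v : Valuation E Γ) (t : ℚ → E) : Prop where
  zero : t 0 = 1
  add : ∀ p q, t (p + q) = t p * t q
  lt_one : ∀ q, 0 < q → v (t q) < 1
  eventually_lt : ∀ x, v x < 1 → ∀ n : ℤ, ∀ᶠ M : ℕ in Filter.atTop, v (t (n / M) * x) < 1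

theorem IsFineScaling.sum {v : Valuation E Γ} {t : ℚ → E} (ht : IsFineScaling v t) {ι : Type*}
    (s : Finset ι) (q : ι → ℚ) : t (∑ i ∈ s, q i) = ∏ i ∈ s, t (q i) := by
  classical
  induction s using Finset.induction_on with
  | empty => simp [ht.zero]
  | insert a s ha ih => rw [Finset.sum_insert ha, Finset.prod_insert ha, ht.add, ih]

/-- The number with binary digits given by `A`. -/
def binaryWeight {N : ℕ} (A : Finset (Fin N)) : ℤ := ∑ s ∈ A, 2 ^ (s : ℕ)

theorem binaryWeight_injective (N : ℕ) :
    Function.Injective (binaryWeight : Finset (Fin N) → ℤ) := by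
  intro A B h
  have key : ∀ A : Finset (Fin N), binaryWeight A =
      ((∑ i ∈ A.map Fin.valEmbedding, 2 ^ i : ℕ) : ℤ) := fun A => by
    simp [binaryWeight, Finset.sum_map]
  rw [key, key] at h
  exact Finset.map_injective _ (Finset.geomSum_injective le_rfl (by exact_mod_cast h))

/-- Additivity ties the weight of one block to those of the others, so that rescaling the remaining
slots can detect which set was contracted. -/
theorem sum_binaryWeight {N j : ℕ} {A : Fin j → Finset (Fin N)} {W : Finset (Fin N)}
    (h : ∑ i, (A i).val = W.val) : ∑ i, binaryWeight (A i) = binaryWeight W := by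
  let F : Multiset (Fin N) →+ ℤ :=
    Multiset.sumAddMonoidHom.comp (Multiset.mapAddMonoidHom fun s : Fin N => (2 : ℤ) ^ (s : ℕ))
  have hF : ∀ B : Finset (Fin N), F B.val = binaryWeight B := fun B => rfl
  rw [← hF, ← h, map_sum]
  rfl

/-- Modulo the maximal ideal, `f` is a direct sum over `x ∈ X` of tensors which are restrictions to
`F x 0 × ⋯ × F x (j - 1)` of the indicator tensor of the partitions of `W x` into `j` sets of
size `m`. -/
structure IsPartitionSum (v : Valuation E Γ) (m : ℕ) {N j : ℕ} {ι : Type} (X : Finset ι)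
    (W : ι → Finset (Fin N)) (F : ι → Fin j → Finset (Finset (Fin N)))
    (f : (Fin j → Finset (Fin N)) → E) : Prop where
  card : ∀ x ∈ X, (W x).card = j * m
  subset : ∀ x ∈ X, ∀ i, F x i ⊆ (W x).powersetCard m
  disj : ∀ x ∈ X, ∀ y ∈ X, ∀ i, ∀ A, A ∈ F x i → A ∈ F y i → x = y
  le_one : ∀ A, (∀ i, ∃ x ∈ X, A i ∈ F x i) → v (f A) ≤ 1
  eq_one_iff : ∀ A, (∀ i, ∃ x ∈ X, A i ∈ F x i) →
    (v (f A) = 1 ↔ ∃ x ∈ X, (∀ i, A i ∈ F x i) ∧ ∑ i, (A i).val = (W x).val)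

theorem disjoint_of_val_add_le {α : Type*} {A B W : Finset α} (h : A.val + B.val ≤ W.val) :
    Disjoint A B := by
  rw [← Finset.disjoint_val]
  exact (Multiset.nodup_add.1 (Multiset.nodup_of_le h W.nodup)).2.2

/-- Contraction of the coordinate `0` of a partition sum with a suitable vector. -/
theorem IsPartitionSum.contract {v : Valuation E Γ} {t : ℚ → E} (ht : IsFineScaling v t)
    {m N j : ℕ} {ι : Type} [DecidableEq ι] {X : Finset ι} {W : ι → Finset (Fin N)}
    {F : ι → Fin (j + 1 + 1) → Finset (Finset (Fin N))}
    {f : (Fin (j + 1 + 1) → Finset (Fin N)) → E} (hf : IsPartitionSum v m X W F f) {r : ℕ}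
    (hr : HasPartitionRankLE r f) :
    ∃ S ⊆ X.biUnion fun x => F x 0, ((X.biUnion fun x => F x 0) \ S).card ≤ r ∧
      ∀ R : ι → Finset (Finset (Fin N)), (∀ x ∈ X, R x ⊆ S ∩ F x 0) →
        ∃ g : (Fin (j + 1) → Finset (Fin N)) → E, HasPartitionRankLE r g ∧
          IsPartitionSum v m ((X ×ˢ Finset.univ).filter fun p : ι × Finset (Fin N) => p.2 ∈ R p.1)
            (fun p => W p.1 \ p.2)
            (fun p i => (F p.1 i.succ).filter fun A =>
              Disjoint A p.2 ∧ ∀ C' ∈ R p.1, C' ≠ p.2 → ¬ Disjoint A C') g := by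
  classical
  obtain ⟨φ, hφ⟩ := hr.contract
  obtain ⟨S, hSF, hcard, u, hu1, huF, -, hule, hult, huφ⟩ :=
    exists_echelon v binaryWeight (binaryWeight_injective N) φ (X.biUnion fun x => F x 0)
      Finset.univ
  refine ⟨S, hSF, by simpa using hcard, fun R hR => ?_⟩
  set X' := (X ×ˢ Finset.univ).filter fun p : ι × Finset (Fin N) => p.2 ∈ R p.1 with hX'
  set F' : ι × Finset (Fin N) → Fin (j + 1) → Finset (Finset (Fin N)) := fun p i =>
    (F p.1 i.succ).filter fun A => Disjoint A p.2 ∧ ∀ C' ∈ R p.1, C' ≠ p.2 → ¬ Disjoint A C'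
    with hF'
  have hX'mem : ∀ p, p ∈ X' ↔ p.1 ∈ X ∧ p.2 ∈ R p.1 := fun p => by simp [hX']
  have hF'mem : ∀ p i A, A ∈ F' p i ↔ A ∈ F p.1 i.succ ∧ Disjoint A p.2 ∧
      ∀ C' ∈ R p.1, C' ≠ p.2 → ¬ Disjoint A C' := fun p i A => by simp [hF']
  have hpS : ∀ p ∈ X', p.2 ∈ S := fun p hp =>
    (Finset.mem_inter.1 (hR _ ((hX'mem p).1 hp).1 ((hX'mem p).1 hp).2)).1
  have hpF : ∀ p ∈ X', p.2 ∈ F p.1 0 := fun p hp =>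
    (Finset.mem_inter.1 (hR _ ((hX'mem p).1 hp).1 ((hX'mem p).1 hp).2)).2
  have hpW : ∀ p ∈ X', p.2 ⊆ W p.1 ∧ p.2.card = m := fun p hp =>
    Finset.mem_powersetCard.1 (hf.subset _ ((hX'mem p).1 hp).1 0 (hpF p hp))
  -- the weight of the ground set to which a set in position `1` belongs
  have hoff : ∃ off : Finset (Fin N) → ℤ, ∀ x ∈ X, ∀ A ∈ F x 1, off A = binaryWeight (W x) := by
    refine ⟨fun A => if h : ∃ x ∈ X, A ∈ F x 1 then binaryWeight (W h.choose) else 0,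
      fun x hx A hA => ?_⟩
    have h : ∃ x ∈ X, A ∈ F x 1 := ⟨x, hx, hA⟩
    dsimp only
    rw [dif_pos h, hf.disj _ h.choose_spec.1 _ hx 1 A h.choose_spec.2 hA]
  obtain ⟨off, hoff⟩ := hoff
  -- The exponent is a sum of contributions of the separate slots and of `p.2`, so it comes from
  -- rescaling basis vectors and the vectors `u p.2`. The weight of the ground set, which depends on
  -- the summand, is read off from `A 0`.
  let e : (Fin (j + 1) → Finset (Fin N)) → ι × Finset (Fin N) → ℤ := fun A p =>
    ∑ i, binaryWeight (A i) - off (A 0) + binaryWeight p.2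
  let term : ℕ → (Fin (j + 1) → Finset (Fin N)) → (ι × Finset (Fin N)) × Finset (Fin N) → E :=
    fun M A q => t (e A q.1 / M) * (u q.1.2 q.2 * f (Fin.cons q.2 A))
  let dom : (Fin (j + 1) → Finset (Fin N)) → Prop := fun A => ∀ i, ∃ p ∈ X', A i ∈ F' p i
  have hdom : ∀ A, dom A → ∀ C ∈ X.biUnion (fun x => F x 0),
      ∀ i : Fin (j + 1 + 1), ∃ x ∈ X, (Fin.cons C A : Fin (j + 1 + 1) → Finset (Fin N)) i ∈ F x i := by
    intro A hA C hC i
    refine Fin.cases ?_ (fun i => ?_) i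
    · simpa using hC
    · obtain ⟨p, hp, hpA⟩ := hA i
      exact ⟨p.1, ((hX'mem p).1 hp).1, by simpa using ((hF'mem p i _).1 hpA).1⟩
  have hsumcons : ∀ (C : Finset (Fin N)) (A : Fin (j + 1) → Finset (Fin N)),
      ∑ i, ((Fin.cons C A : Fin (j + 1 + 1) → Finset (Fin N)) i).val = C.val + ∑ i, (A i).val :=
    fun C A => by rw [Fin.sum_univ_succ]; simp
  -- exponent of terms on the support
  have hexp : ∀ A C x, x ∈ X → (∀ i, (Fin.cons C A : Fin (j + 1 + 1) → Finset (Fin N)) i ∈ F x i) →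
      ∑ i, ((Fin.cons C A : Fin (j + 1 + 1) → Finset (Fin N)) i).val = (W x).val →
      ∀ p, e A p = binaryWeight p.2 - binaryWeight C := by
    intro A C x hx hmem hsum p
    have h1 := sum_binaryWeight hsum
    rw [Fin.sum_univ_succ] at h1
    simp only [Fin.cons_zero, Fin.cons_succ] at h1
    have h2 := hoff x hx (A 0) (by simpa using hmem 1)
    simp only [e, h2]
    linarith
  have hsmall : ∀ A, dom A → ∀ p ∈ X', ∀ C, ¬ (C = p.2 ∧ v (f (Fin.cons C A)) = 1) →
      ∀ᶠ M : ℕ in Filter.atTop, v (term M A (p, C)) < 1 := by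
    intro A hA p hp C hne
    by_cases hC : C ∈ X.biUnion fun x => F x 0
    swap
    · refine Filter.Eventually.of_forall fun M => ?_
      simp only [term, huF _ (hpS p hp) C hC, zero_mul, mul_zero, map_zero]
      exact zero_lt_one
    have hfle := hf.le_one _ (hdom A hA C hC)
    rcases hfle.lt_or_eq with hlt | heq
    -- Off the support the exponent may be negative, but the term already lies in the maximal ideal
    -- and survives a sufficiently small scaling.
    · refine ht.eventually_lt _ ?_ _
      rw [map_mul]
      exact mul_lt_one_of_nonneg_of_lt_one_right (hule _ (hpS p hp) C) zero_le hlt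
    · have hCp : C ≠ p.2 := fun h => hne ⟨h, heq⟩
      rcases hult _ (hpS p hp) C hCp with h | h
      · refine ht.eventually_lt _ ?_ _
        rw [map_mul]
        exact mul_lt_one_of_nonneg_of_lt_one_left zero_le h hfle
      -- On the support the exponent is the weight of `p.2` minus that of `C`, which is positive
      -- because `C` comes earlier.
      · obtain ⟨x, hx, hmem, hsum⟩ := (hf.eq_one_iff _ (hdom A hA C hC)).1 heq
        filter_upwards [Filter.eventually_gt_atTop 0] with M hM
        simp only [term, hexp A C x hx hmem hsum p]
        rw [map_mul, map_mul]
        refine mul_lt_one_of_nonneg_of_lt_one_left zero_le (ht.lt_one _ ?_)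
          (mul_le_one' (hule _ (hpS p hp) C) hfle)
        have : (0 : ℚ) < ((binaryWeight p.2 - binaryWeight C : ℤ) : ℚ) := by
          exact_mod_cast sub_pos.2 h
        positivity
  -- Only finitely many triples occur, so one `M` serves them all.
  obtain ⟨M, hM⟩ : ∃ M : ℕ, ∀ A, dom A → ∀ p ∈ X', ∀ C,
      ¬ (C = p.2 ∧ v (f (Fin.cons C A)) = 1) → v (term M A (p, C)) < 1 := by
    have : ∀ᶠ M : ℕ in Filter.atTop, ∀ A, ∀ p ∈ X', ∀ C, dom A →
        ¬ (C = p.2 ∧ v (f (Fin.cons C A)) = 1) → v (term M A (p, C)) < 1 := by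
      refine Filter.eventually_all.2 fun A => (Filter.eventually_all_finset X').2 fun p hp =>
        Filter.eventually_all.2 fun C => ?_
      by_cases h : dom A ∧ ¬ (C = p.2 ∧ v (f (Fin.cons C A)) = 1)
      · exact (hsmall A h.1 p hp C h.2).mono fun M hM _ _ => hM
      · exact Filter.Eventually.of_forall fun M h1 h2 => absurd ⟨h1, h2⟩ h
    obtain ⟨M, hM⟩ := this.exists
    exact ⟨M, fun A hA p hp C h => hM A p hp C hA h⟩
  have hmain : ∀ A, dom A → ∀ p ∈ X', v (f (Fin.cons p.2 A)) = 1 → v (term M A (p, p.2)) = 1 := by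
    intro A hA p hp h
    obtain ⟨x, hx, hmem, hsum⟩ := (hf.eq_one_iff _ (hdom A hA p.2 (hSF (hpS p hp)))).1 h
    simp only [term, hexp A _ x hx hmem hsum p, sub_self, Int.cast_zero, zero_div, ht.zero,
      hu1 _ (hpS p hp), one_mul, h]
  let g : (Fin (j + 1) → Finset (Fin N)) → E := fun A => ∑ q ∈ X' ×ˢ Finset.univ, term M A q
  have hstruct : ∀ A, dom A → ∀ p ∈ X', (v (f (Fin.cons p.2 A)) = 1 ↔
      (∀ i, A i ∈ F' p i) ∧ ∑ i, (A i).val = (W p.1 \ p.2).val) := by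
    intro A hA p hp
    have hpX := ((hX'mem p).1 hp).1
    have hval : p.2.val + (W p.1 \ p.2).val = (W p.1).val := by
      rw [Finset.sdiff_val, add_tsub_cancel_of_le (Finset.val_le_iff.2 (hpW p hp).1)]
    rw [hf.eq_one_iff _ (hdom A hA p.2 (hSF (hpS p hp)))]
    constructor
    · rintro ⟨x, hx, hmem, hsum⟩
      have hxp : x = p.1 := hf.disj _ hx _ hpX 0 _ (by simpa using hmem 0) (hpF p hp)
      subst hxp
      rw [hsumcons] at hsum
      refine ⟨fun i => ?_, ?_⟩
      · obtain ⟨q, hq, hqA⟩ := hA i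
        have h1 := (hF'mem q i _).1 hqA
        have h2 : q.1 = p.1 := hf.disj _ ((hX'mem q).1 hq).1 _ hpX i.succ _ h1.1
          (by simpa using hmem i.succ)
        have h3 : Disjoint (A i) p.2 := by
          refine (disjoint_of_val_add_le (W := W p.1) ?_).symm
          rw [← hsum]
          gcongr
          exact Finset.single_le_sum (f := fun i => (A i).val) (fun _ _ => zero_le)
            (Finset.mem_univ i)
        -- The thinning is used here: a set kept for `q` is disjoint from no other member of the
        -- same family `R`.
        have h4 : p.2 = q.2 := by
          by_contra hne
          exact h1.2.2 p.2 (h2 ▸ ((hX'mem p).1 hp).2) hne h3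
        have : q = p := Prod.ext h2 h4.symm
        exact this ▸ hqA
      · exact add_left_cancel (hsum.trans hval.symm)
    · rintro ⟨hmem, hsum⟩
      refine ⟨p.1, hpX, fun i => ?_, ?_⟩
      · refine Fin.cases ?_ (fun i => ?_) i
        · simpa using hpF p hp
        · simpa using ((hF'mem p i _).1 (hmem i)).1
      · rw [hsumcons, hsum, hval]
  have hle : ∀ A, dom A → ∀ q ∈ X' ×ˢ (Finset.univ : Finset (Finset (Fin N))),
      v (term M A q) ≤ 1 := by
    rintro A hA ⟨p, C⟩ hq
    have hp := (Finset.mem_product.1 hq).1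
    by_cases h : C = p.2 ∧ v (f (Fin.cons C A)) = 1
    · obtain ⟨rfl, h⟩ := h
      exact (hmain A hA p hp h).le
    · exact (hM A hA p hp C h).le
  refine ⟨g, ?_, ?_, ?_, ?_, ?_, ?_⟩
  -- Up to rescaling, `g` is a single contraction, by a combination of the vectors `u p.2`; hence
  -- the bound `r` is not multiplied by the number of copies.
  · have h1 := hφ (fun C => ∑ p ∈ X', t (binaryWeight p.2 / M) * u p.2 C) fun l => by
      simp only [Finset.sum_mul, mul_assoc]
      rw [Finset.sum_comm]
      refine Finset.sum_eq_zero fun p hp => ?_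
      rw [← Finset.mul_sum, huφ _ (hpS p hp) l (Finset.mem_univ _), mul_zero]
    have h2 := h1.mul_prod fun i A => t ((binaryWeight A - if i = 0 then off A else 0 : ℤ) / M)
    convert h2 using 2 with A
    rw [← ht.sum]
    simp only [g, term, Finset.sum_product, Finset.sum_mul, Finset.mul_sum]
    rw [Finset.sum_comm]
    refine Finset.sum_congr rfl fun C _ => Finset.sum_congr rfl fun p _ => ?_
    have : ((e A p : ℤ) : ℚ) / M =
        ∑ i, ((binaryWeight (A i) - if i = 0 then off (A i) else 0 : ℤ) : ℚ) / M +
          (binaryWeight p.2 : ℚ) / M := by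
      rw [← Finset.sum_div, ← add_div]
      congr 1
      simp only [e]
      push_cast
      rw [Finset.sum_sub_distrib]
      simp
    rw [this, ht.add]
    ring
  · intro p hp
    rw [Finset.card_sdiff_of_subset (hpW p hp).1, (hpW p hp).2, hf.card _ ((hX'mem p).1 hp).1,
      Nat.succ_mul, Nat.add_sub_cancel]
  · intro p hp i A hA
    have h1 := (hF'mem p i A).1 hA
    have h2 := Finset.mem_powersetCard.1 (hf.subset _ ((hX'mem p).1 hp).1 _ h1.1)
    exact Finset.mem_powersetCard.2 ⟨Finset.subset_sdiff.2 ⟨h2.1, h1.2.1⟩, h2.2⟩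
  · intro p hp q hq i A hpA hqA
    have h1 := (hF'mem p i A).1 hpA
    have h2 := (hF'mem q i A).1 hqA
    have h3 : p.1 = q.1 :=
      hf.disj _ ((hX'mem p).1 hp).1 _ ((hX'mem q).1 hq).1 i.succ A h1.1 h2.1
    refine Prod.ext h3 ?_
    by_contra hne
    exact h2.2.2 p.2 (h3 ▸ ((hX'mem p).1 hp).2) hne h1.2.1
  · intro A hA
    exact v.map_sum_le (hle A hA)
  · intro A hA
    constructor
    · intro h
      by_contra! hcon
      refine absurd h (ne_of_lt (v.map_sum_lt' zero_lt_one ?_))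
      rintro ⟨p, C⟩ hq
      have hp := (Finset.mem_product.1 hq).1
      refine hM A hA p hp C ?_
      rintro ⟨rfl, h1⟩
      have h2 := (hstruct A hA p hp).1 h1
      exact hcon p hp h2.1 h2.2
    · rintro ⟨p, hp, hmem, hsum⟩
      have h1 := (hstruct A hA p hp).2 ⟨hmem, hsum⟩
      have h2 := hmain A hA p hp h1
      change v (∑ q ∈ X' ×ˢ Finset.univ, term M A q) = 1
      -- Exactly one term is a unit: `A 0` determines the summand `x`, and the union of the `A i` is
      -- the complement of `C` in `W x`.
      rw [v.map_sum_eq_of_lt (j := (p, p.2)) (by simp [hp]), h2]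
      rintro ⟨q, C⟩ hq
      rw [h2]
      obtain ⟨hq, hne⟩ := Finset.mem_sdiff.1 hq
      refine hM A hA q (Finset.mem_product.1 hq).1 C ?_
      rintro ⟨rfl, h3⟩
      have h4 := (hstruct A hA q (Finset.mem_product.1 hq).1).1 h3
      refine hne (Finset.mem_singleton.2 ?_)
      have hqX := (Finset.mem_product.1 hq).1
      have h5 : q.1 = p.1 := hf.disj _ ((hX'mem q).1 hqX).1 _ ((hX'mem p).1 hp).1 (Fin.succ 0) _
        ((hF'mem q 0 _).1 (h4.1 0)).1 ((hF'mem p 0 _).1 (hmem 0)).1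
      have h6 : q.2.val + (W q.1 \ q.2).val = (W q.1).val := by
        rw [Finset.sdiff_val, add_tsub_cancel_of_le (Finset.val_le_iff.2 (hpW q hqX).1)]
      have h7 : p.2.val + (W p.1 \ p.2).val = (W p.1).val := by
        rw [Finset.sdiff_val, add_tsub_cancel_of_le (Finset.val_le_iff.2 (hpW p hp).1)]
      have h8 : q.2 = p.2 := by
        rw [← h4.2, h5] at h6
        rw [← hsum] at h7
        exact Finset.val_inj.1 (add_right_cancel (h6.trans h7.symm))
      have : q = p := Prod.ext h5 h8
      rw [this]

end PartitionTensors

/-! ### The induction bounding the partition rank below -/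

section LowerBound

variable {E Γ : Type*} [Field E] [LinearOrderedCommGroupWithZero Γ]

/-- A direct sum of sufficiently dense restrictions of partition tensors has partition rank
proportional to the sum of the dimensions. -/
theorem IsPartitionSum.exists_lt_of_hasPartitionRankLE {v : Valuation E Γ} {t : ℚ → E}
    (ht : IsFineScaling v t) (j : ℕ) :
    ∃ δ : ℝ, 0 < δ ∧ ∃ c : ℝ, 0 < c ∧ ∀ (N m : ℕ) (ι : Type) (X : Finset ι)
      (W : ι → Finset (Fin N)) (F : ι → Fin (j + 1) → Finset (Finset (Fin N)))
      (f : (Fin (j + 1) → Finset (Fin N)) → E), IsPartitionSum v m X W F f → X.Nonempty →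
      (∀ x ∈ X, ∀ i, ((((W x).powersetCard m) \ F x i).card : ℝ) ≤
        δ * ((j + 1) * m).choose m) →
      ∀ r : ℕ, HasPartitionRankLE r f → c * (X.card * ((j + 1) * m).choose m) < r := by
  classical
  induction j with
  | zero =>
    -- With one slot, `W x` is the only `m`-set, and missing at most half a set means missing none.
    -- So `f` is nonzero, no `r` is possible, and the constant `c = 1` is arbitrary.
    refine ⟨1 / 2, by norm_num, 1, one_pos, fun N m ι X W F f hf hX hδ r hr => ?_⟩
    exfalso
    obtain ⟨x, hx⟩ := hX
    have hW : (W x).card = m := by simpa using hf.card x hx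
    have hmem : W x ∈ F x 0 := by
      by_contra hcon
      have h1 : W x ∈ (W x).powersetCard m \ F x 0 :=
        Finset.mem_sdiff.2 ⟨Finset.mem_powersetCard.2 ⟨subset_rfl, hW⟩, hcon⟩
      have h2 : (1 : ℝ) ≤ (((W x).powersetCard m) \ F x 0).card := by
        exact_mod_cast Finset.card_pos.2 ⟨_, h1⟩
      have h3 := hδ x hx 0
      simp only [zero_add, one_mul, Nat.choose_self, Nat.cast_one] at h3
      linarith
    have hmem' : ∀ i, W x ∈ F x i := fun i => Fin.fin_one_eq_zero i ▸ hmem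
    have h1 := (hf.eq_one_iff (fun _ => W x) fun i => ⟨x, hx, hmem' i⟩).2
      ⟨x, hx, hmem', by simp⟩
    rw [hr.eq_zero] at h1
    simp at h1
  | succ j ih =>
    obtain ⟨δ₁, hδ₁, c, hc, ih⟩ := ih
    set δ' := min δ₁ 1 with hδ'
    have hδ'0 : 0 < δ' := lt_min hδ₁ one_pos
    -- The first `1 / 8` and the `1 / 8` allowed for elimination losses add up to the `1 / 4` of
    -- `exists_dispersed`; the other bound is its condition for `j + 1` slots. The factor `1 / 16`
    -- ensures that at most half of the copies lose more, and `c * δ' / 32` is `c` times that half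
    -- times the density `δ' / 16` of `R`.
    refine ⟨min (1 / 8) (δ' / (8 * ((j + 1 : ℕ) + 1))), by positivity,
      min (1 / 16) (c * δ' / 32), by positivity, fun N m ι X W F f hf hX hδ r hr => ?_⟩
    by_contra! hcon
    obtain ⟨S, hSF, hScard, hS⟩ := hf.contract ht hr
    set n := (j + 1) * m with hn
    have hmul : (j + 1 + 1) * m = n + m := by rw [hn, Nat.succ_mul]
    rw [hmul] at hcon hδ
    have hnm : m ≤ n := by rw [hn]; exact Nat.le_mul_of_pos_left m (Nat.succ_pos j)
    set D : ℝ := ((n + m).choose m : ℝ) with hD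
    set d : ℝ := (n.choose m : ℝ) with hd
    have hDpos : 0 < D := by
      rw [hD]; exact_mod_cast Nat.choose_pos (Nat.le_add_left m n)
    have hdpos : 0 < d := by rw [hd]; exact_mod_cast Nat.choose_pos hnm
    have hXpos : (0 : ℝ) < X.card := by exact_mod_cast hX.card_pos
    -- the copies in which few coordinates are lost
    set X₁ := X.filter fun x => ((F x 0 \ S).card : ℝ) ≤ 1 / 8 * D with hX₁
    set X₂ := X.filter fun x => ¬ ((F x 0 \ S).card : ℝ) ≤ 1 / 8 * D with hX₂
    have hX₁₂ : (X₁.card : ℝ) + X₂.card = X.card := by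
      exact_mod_cast Finset.card_filter_add_card_filter_not _
    have hsum : ∑ x ∈ X, (F x 0 \ S).card ≤ r := by
      refine le_trans (le_of_eq ?_) hScard
      rw [← Finset.card_biUnion]
      · congr 1
        ext A
        simp only [Finset.mem_biUnion, Finset.mem_sdiff]
        tauto
      · intro x hx y hy hxy
        refine Finset.disjoint_left.2 fun A hA hA' => hxy ?_
        exact hf.disj x hx y hy 0 A (Finset.mem_sdiff.1 hA).1 (Finset.mem_sdiff.1 hA').1
    have hX₂c : (X₂.card : ℝ) ≤ X.card / 2 := by
      have h1 : ∑ x ∈ X₂, 1 / 8 * D ≤ ∑ x ∈ X, ((F x 0 \ S).card : ℝ) :=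
        (Finset.sum_le_sum fun x hx => (not_le.1 (Finset.mem_filter.1 hx).2).le).trans
          (Finset.sum_le_sum_of_subset_of_nonneg (Finset.filter_subset _ _)
            fun _ _ _ => by positivity)
      have h2 : ∑ x ∈ X, ((F x 0 \ S).card : ℝ) ≤ r := by exact_mod_cast hsum
      rw [Finset.sum_const, nsmul_eq_mul] at h1
      have h3 : min (1 / 16) (c * δ' / 32) * (X.card * D) ≤ 1 / 16 * (X.card * D) :=
        mul_le_mul_of_nonneg_right (min_le_left _ _) (by positivity)
      have h4 : (X₂.card : ℝ) * (1 / 8 * D) ≤ X.card / 2 * (1 / 8 * D) := by linarith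
      exact le_of_mul_le_mul_right h4 (by positivity)
    have hdisp : ∀ x ∈ X₁, ∃ R ⊆ S ∩ F x 0, δ' / 16 * D ≤ R.card * d ∧
        ∀ C ∈ R, ∀ i : Fin (j + 1), ((((W x).powersetCard m).filter fun A => Disjoint A C ∧
          (A ∈ (W x).powersetCard m \ F x i.succ ∨ ∃ C' ∈ R, C' ≠ C ∧ Disjoint A C')).card : ℝ) ≤
            δ' * d := fun x hx => by
      obtain ⟨hxX, hxS⟩ := Finset.mem_filter.1 hx
      obtain ⟨R, hR, hRc, hRd⟩ := exists_dispersed hδ'0 (min_le_right _ _) hnm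
        ((hf.card x hxX).trans hmul) ((W x).powersetCard m \ (S ∩ F x 0))
        (fun i => (W x).powersetCard m \ F x i.succ) (by
          have h1 : (W x).powersetCard m \ (S ∩ F x 0) ⊆
              ((W x).powersetCard m \ F x 0) ∪ (F x 0 \ S) := fun A hA => by
            simp only [Finset.mem_sdiff, Finset.mem_inter, Finset.mem_union] at hA ⊢
            tauto
          have h2 : (((W x).powersetCard m \ (S ∩ F x 0)).card : ℝ) ≤
              ((W x).powersetCard m \ F x 0).card + (F x 0 \ S).card := by
            exact_mod_cast (Finset.card_le_card h1).trans (Finset.card_union_le _ _)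
          have h3 := (hδ x hxX 0).trans
            (mul_le_mul_of_nonneg_right (min_le_left _ _) hDpos.le)
          linarith)
        (fun i => Finset.sdiff_subset)
        (fun i => (hδ x hxX i.succ).trans
          (mul_le_mul_of_nonneg_right (min_le_right _ _) hDpos.le))
      refine ⟨R, fun A hA => ?_, hRc, hRd⟩
      have := hR hA
      simp only [Finset.mem_sdiff] at this
      tauto
    choose! R₁ hR₁S hR₁c hR₁ using hdisp
    set R : ι → Finset (Finset (Fin N)) := fun x => if x ∈ X₁ then R₁ x else ∅ with hR
    have hRin : ∀ x ∈ X₁, R x = R₁ x := fun x hx => if_pos hx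
    have hRout : ∀ x, x ∉ X₁ → R x = ∅ := fun x hx => if_neg hx
    obtain ⟨g, hgr, hg⟩ := hS R fun x _ => by
      by_cases hx : x ∈ X₁
      · rw [hRin x hx]; exact hR₁S x hx
      · rw [hRout x hx]; exact Finset.empty_subset _
    set X' := (X ×ˢ Finset.univ).filter fun p : ι × Finset (Fin N) => p.2 ∈ R p.1 with hX'
    have hX'mem : ∀ p, p ∈ X' ↔ p.1 ∈ X₁ ∧ p.2 ∈ R₁ p.1 := fun p => by
      simp only [hX', Finset.mem_filter, Finset.mem_product, Finset.mem_univ, and_true]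
      by_cases hx : p.1 ∈ X₁
      · simp [hRin _ hx, hx, (Finset.mem_filter.1 hx).1]
      · simp [hRout _ hx, hx]
    have hX'c : X.card / 2 * (δ' / 16 * D) ≤ X'.card * d := by
      have h1 : X' = (X₁.sigma R₁).map (Equiv.sigmaEquivProd _ _).toEmbedding := by
        ext p
        rw [hX'mem]
        simp
      rw [h1, Finset.card_map, Finset.card_sigma, Nat.cast_sum, Finset.sum_mul]
      calc _ ≤ (X₁.card : ℝ) * (δ' / 16 * D) := by gcongr; linarith
        _ = ∑ x ∈ X₁, δ' / 16 * D := by rw [Finset.sum_const, nsmul_eq_mul]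
        _ ≤ _ := Finset.sum_le_sum hR₁c
    have hX'ne : X'.Nonempty := by
      rw [← Finset.card_pos]
      have : (0 : ℝ) < X'.card * d := lt_of_lt_of_le (by positivity) hX'c
      exact_mod_cast pos_of_mul_pos_left this hdpos.le
    have hlt := ih N m _ X' _ _ g hg hX'ne (fun p hp i => by
      obtain ⟨hp1, hp2⟩ := (hX'mem p).1 hp
      refine le_trans ?_ ((hR₁ p.1 hp1 p.2 hp2 i).trans
        (mul_le_mul_of_nonneg_right (min_le_left _ _) hdpos.le))
      norm_cast
      refine Finset.card_le_card fun A hA => ?_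
      rw [hRin _ hp1] at hA
      simp only [Finset.mem_sdiff, Finset.mem_powersetCard, Finset.mem_filter,
        Finset.subset_sdiff] at hA ⊢
      obtain ⟨⟨⟨h1, h2⟩, h3⟩, h4⟩ := hA
      refine ⟨⟨h1, h3⟩, h2, ?_⟩
      by_cases h5 : A ∈ F p.1 i.succ
      · right
        by_contra! h6
        exact h4 ⟨h5, h2, h6⟩
      · exact Or.inl ⟨⟨h1, h3⟩, h5⟩) r hgr
    have h3 : min (1 / 16) (c * δ' / 32) * (X.card * D) ≤ c * δ' / 32 * (X.card * D) :=
      mul_le_mul_of_nonneg_right (min_le_right _ _) (by positivity)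
    have h4 : c * (X.card / 2 * (δ' / 16 * D)) ≤ c * (X'.card * d) :=
      mul_le_mul_of_nonneg_left hX'c hc.le
    linarith

end LowerBound

/-! ### Hahn series as the valued field -/

section HahnSeriesScaling

variable (K : Type*) [Field K]

/-- The order valuation on Hahn series with rational exponents, in multiplicative notation. -/
noncomputable def hahnValuation : Valuation (HahnSeries ℚ K) (Multiplicative (WithTop ℚ)ᵒᵈ) :=
  AddValuation.toValuation (HahnSeries.addVal ℚ K)

theorem hahnValuation_lt_one {x : HahnSeries ℚ K} :
    hahnValuation K x < 1 ↔ 0 < x.orderTop := by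
  rw [← HahnSeries.addVal_apply]
  exact Iff.rfl

/-- Rational exponents make the value group dense: `n / M` tends to 0, so a positive order stays
positive after adding it. -/
theorem isFineScaling_hahnValuation :
    IsFineScaling (hahnValuation K) fun q => HahnSeries.single q (1 : K) where
  zero := rfl
  add p q := by rw [HahnSeries.single_mul_single, one_mul]
  lt_one q hq := by
    rw [hahnValuation_lt_one, HahnSeries.orderTop_single one_ne_zero]
    exact_mod_cast hq
  eventually_lt x hx n := by
    by_cases h0 : x = 0
    · simp [h0]
    rw [hahnValuation_lt_one, ← HahnSeries.order_eq_orderTop_of_ne_zero h0] at hx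
    have hx' : 0 < x.order := by exact_mod_cast hx
    have hlim : Filter.Tendsto (fun M : ℕ => (n : ℚ) / M + x.order) Filter.atTop
        (nhds (0 + x.order)) :=
      (tendsto_const_div_atTop_nhds_zero_nat (n : ℚ)).add_const _
    rw [zero_add] at hlim
    filter_upwards [hlim.eventually (lt_mem_nhds hx')] with M hM
    rw [hahnValuation_lt_one, HahnSeries.orderTop_mul, HahnSeries.orderTop_single one_ne_zero,
      ← HahnSeries.order_eq_orderTop_of_ne_zero h0]
    exact_mod_cast hM

/-- The genericity arguments need an infinite field even when `K` is finite. -/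
instance : Infinite (HahnSeries ℚ K) :=
  Infinite.of_injective (fun q : ℚ => HahnSeries.single q (1 : K)) fun p q h => by
    have := congrArg HahnSeries.orderTop h
    simpa [HahnSeries.orderTop_single] using this

end HahnSeriesScaling

/-! ### Multilinear forms and factoring -/

section Form

variable {R : Type*} [CommRing R] {k : ℕ} {ι : Fin k → Type*} [∀ i, Fintype (ι i)]

/-- The multilinear form with coefficients `f`. -/
noncomputable def form (f : (∀ i, ι i) → R) : MultilinearMap R (fun i => ι i → R) R :=
  ∑ a, f a • (MultilinearMap.mkPiAlgebra R (Fin k) R).compLinearMap fun i => LinearMap.proj (a i)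

theorem form_apply (f : (∀ i, ι i) → R) (x : ∀ i, ι i → R) :
    form f x = ∑ a, f a * ∏ i, x i (a i) := by
  simp [form]

theorem form_single [∀ i, DecidableEq (ι i)] (f : (∀ i, ι i) → R) (a : ∀ i, ι i) :
    form f (fun i => Pi.single (a i) 1) = f a := by
  rw [form_apply, Finset.sum_eq_single a]
  · simp
  · intro b _ hb
    obtain ⟨i, hi⟩ := Function.ne_iff.1 hb
    rw [Finset.prod_eq_zero (Finset.mem_univ i), mul_zero]
    simp [hi]
  · simp

theorem map_form {R' : Type*} [CommRing R'] (σ : R →+* R') (f : (∀ i, ι i) → R)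
    (x : ∀ i, ι i → R) : σ (form f x) = form (fun a => σ (f a)) fun i a => σ (x i a) := by
  simp [form_apply]

/-- `f` is a product of a function of the coordinates in `I` and a function of the remaining ones:
the `2 × 2` minors of its `I`-flattening vanish. -/
def FactorsAlong {ι : Fin k → Type*} (f : (∀ i, ι i) → R) (I : Finset (Fin k)) : Prop :=
  ∀ a a', f a * f a' = f (I.piecewise a a') * f (I.piecewise a' a)

end Form

/-! ### Linear families of matrices of rank at most one -/

section RankOne

variable {E : Type*} [Field E]

theorem proportional_trans {A : Type*} {a c a' : A → E} (hc : c ≠ 0)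
    (h1 : ∀ x x', a x * c x' = a x' * c x) (h2 : ∀ x x', c x * a' x' = c x' * a' x) (x x' : A) :
    a x * a' x' = a x' * a' x := by
  obtain ⟨x₀, h0⟩ := Function.ne_iff.1 hc
  have h0 : c x₀ ≠ 0 := h0
  have e1 : ∀ x, a x = a x₀ / c x₀ * c x := fun x => by
    field_simp
    rw [h1 x x₀]
  rw [e1 x, e1 x', mul_assoc, h2 x x', mul_assoc]

theorem exists_eq_mul_of_minors {A B : Type*} (M : A → B → E)
    (h : ∀ x x' y y', M x y * M x' y' = M x y' * M x' y) :
    ∃ (a : A → E) (b : B → E), (∀ x y, M x y = a x * b y) ∧ (a = 0 ↔ b = 0) := by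
  by_cases h0 : ∃ x₀ y₀, M x₀ y₀ ≠ 0
  · obtain ⟨x₀, y₀, h0⟩ := h0
    refine ⟨fun x => M x y₀, fun y => M x₀ y / M x₀ y₀, fun x y => ?_, ?_⟩
    · field_simp
      rw [h]
    · refine iff_of_false (fun h => h0 (congrFun h x₀)) fun h => ?_
      simpa [h0] using congrFun h y₀
  · push Not at h0
    exact ⟨0, 0, fun x y => by simp [h0], by simp⟩

/-- A linear family of matrices of rank at most one has a common column space or a common row
space. -/
theorem minors_of_additive_family {V A B : Type*} [AddCommGroup V] (M : V → A → B → E)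
    (hadd : ∀ z z' x y, M (z + z') x y = M z x y + M z' x y)
    (h : ∀ z x x' y y', M z x y * M z x' y' = M z x y' * M z x' y) :
    (∀ z z' x x' y y', M z x y * M z' x' y' = M z x y' * M z' x' y) ∨
      ∀ z z' x x' y y', M z x y * M z' x' y' = M z x' y * M z' x y' := by
  choose a b hM hab using fun z => exists_eq_mul_of_minors (M z) (h z)
  -- A 2 × 2 minor of `M (z + z')` is the product of a minor of the pair `a z, a z'` and one of the
  -- pair `b z, b z'`.
  have key : ∀ z z', (∀ x x', a z x * a z' x' = a z x' * a z' x) ∨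
      ∀ y y', b z y * b z' y' = b z y' * b z' y := by
    intro z z'
    by_contra! hcon
    obtain ⟨⟨x, x', hx⟩, y, y', hy⟩ := hcon
    have h1 := h (z + z') x x' y y'
    simp only [hadd, hM] at h1
    refine mul_ne_zero (sub_ne_zero.2 hx) (sub_ne_zero.2 hy) ?_
    linear_combination h1
  by_contra! hcon
  obtain ⟨⟨z₁, z₁', x₁, x₁', y₁, y₁', h₁⟩, z₂, z₂', x₂, x₂', y₂, y₂', h₂⟩ := hcon
  have hb : ¬ ∀ y y', b z₁ y * b z₁' y' = b z₁ y' * b z₁' y := fun hb => h₁ <| by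
    simp only [hM]
    linear_combination a z₁ x₁ * a z₁' x₁' * hb y₁ y₁'
  have ha : ¬ ∀ x x', a z₂ x * a z₂' x' = a z₂ x' * a z₂' x := fun ha => h₂ <| by
    simp only [hM]
    linear_combination b z₂ y₂ * b z₂' y₂' * ha x₂ x₂'
  have hb1 : a z₁ ≠ 0 := fun h => hb fun y y' => by simp [(hab z₁).1 h]
  have hb1' : a z₁' ≠ 0 := fun h => hb fun y y' => by simp [(hab z₁').1 h]
  have ha1 := (key z₁ z₁').resolve_right hb
  -- A nonzero `b z` cannot be parallel to both `b z₁` and `b z₁'`, which are independent; so `a z`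
  -- is parallel to `a z₁` or `a z₁'`, which span the same line.
  have hall : ∀ z, ∀ x x', a z x * a z₁ x' = a z x' * a z₁ x := by
    intro z
    rcases key z z₁ with h3 | h3
    · exact h3
    rcases key z z₁' with h4 | h4
    · exact proportional_trans hb1' h4 fun x x' => by linear_combination - ha1 x x'
    · by_cases hz : b z = 0
      · intro x x'
        simp [(hab z).2 hz]
      · exact absurd (proportional_trans hz (fun y y' => by linear_combination - h3 y y') h4) hb
  exact ha (proportional_trans hb1 (hall z₂) fun x x' => by linear_combination - hall z₂' x x')

end RankOne

/-! ### From minors in two slots to a factorisation -/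

section Generic

variable {E : Type*} [Field E]

/-- The product of the polynomials is nonzero, and over an infinite field it cannot vanish
everywhere. -/
theorem exists_forall_eval_ne_zero [Infinite E] {σ τ : Type*} (s : Finset τ)
    (P : τ → MvPolynomial σ E) (h : ∀ i ∈ s, ∃ x, MvPolynomial.eval x (P i) ≠ 0) :
    ∃ x, ∀ i ∈ s, MvPolynomial.eval x (P i) ≠ 0 := by
  have h1 : ∏ i ∈ s, P i ≠ 0 := Finset.prod_ne_zero_iff.2 fun i hi h0 => by
    obtain ⟨x, hx⟩ := h i hi
    exact hx (by rw [h0, map_zero])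
  by_contra! hcon
  refine h1 (MvPolynomial.funext fun x => ?_)
  obtain ⟨i, hi, hx⟩ := hcon x
  rw [map_prod, map_zero, Finset.prod_eq_zero hi hx]

theorem exists_mvPolynomial_eval_eq {ι : Type*} [Fintype ι] (ψ : (ι → E) →ₗ[E] E) :
    ∃ P : MvPolynomial ι E, ∀ z, MvPolynomial.eval z P = ψ z := by
  classical
  refine ⟨∑ a, MvPolynomial.C (ψ (Pi.single a 1)) * MvPolynomial.X a, fun z => ?_⟩
  rw [ψ.pi_apply_eq_sum_univ z]
  simp only [map_sum, map_mul, MvPolynomial.eval_C, MvPolynomial.eval_X, smul_eq_mul]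
  refine Finset.sum_congr rfl fun a _ => ?_
  rw [mul_comm]
  congr 2
  ext b
  simp [Pi.single_apply, eq_comm]

variable {k : ℕ} {ι : Fin k → Type*} [∀ i, Fintype (ι i)]

/-- If a multilinear form has, after fixing all arguments but those in positions `i` and `j`,
rank at most one, then it factors along a set that contains `i` but not `j`. -/
theorem exists_factors_of_minors [Infinite E] (F : MultilinearMap E (fun i => ι i → E) E)
    {i j : Fin k} (hij : i ≠ j)
    (h : ∀ v x x' y y',
      F (Function.update (Function.update v i x) j y) *
        F (Function.update (Function.update v i x') j y') =
      F (Function.update (Function.update v i x) j y') *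
        F (Function.update (Function.update v i x') j y))
    (J : Finset (Fin k)) (hJ : i ∉ J ∧ j ∉ J) (v : ∀ i, ι i → E) :
    ∃ I : Finset (Fin k), i ∈ I ∧ j ∉ I ∧ ∀ x y : ∀ i, ι i → E,
      F ((insert i (insert j J)).piecewise x v) * F ((insert i (insert j J)).piecewise y v) =
        F ((insert i (insert j J)).piecewise (I.piecewise x y) v) *
          F ((insert i (insert j J)).piecewise (I.piecewise y x) v) := by
  classical
  induction J using Finset.induction_on generalizing v with
  | empty =>
    refine ⟨{i}, by simp, by simpa using hij.symm, fun x y => ?_⟩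
    have e : ∀ x : ∀ i, ι i → E, (insert i (insert j (∅ : Finset (Fin k)))).piecewise x v =
        Function.update (Function.update v i (x i)) j (x j) := fun x => by
      ext l : 1
      by_cases hl : l = j
      · subst hl; simp
      · by_cases hl' : l = i
        · subst hl'; simp [hl]
        · simp [hl, hl']
    simp only [e]
    simpa [hij.symm] using h v (x i) (y i) (x j) (y j)
  | insert l J hl ih =>
    obtain ⟨hiJ, hjJ⟩ := hJ
    rw [Finset.mem_insert, not_or] at hiJ hjJ
    set J' := insert i (insert j J) with hJ'
    have hlJ' : l ∉ J' := by
      simp [hJ', hl, Ne.symm hiJ.1, Ne.symm hjJ.1]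
    have hins : insert i (insert j (insert l J)) = insert l J' := by
      rw [hJ', Finset.insert_comm j l, Finset.insert_comm i l]
    rw [hins]
    have hup : ∀ (x : ∀ i, ι i → E) z,
        J'.piecewise x (Function.update v l z) = Function.update (J'.piecewise x v) l z :=
      fun x z => (Finset.update_piecewise_of_notMem (s := J') (i := l) x v hlJ' z).symm
    -- Induction gives a set depending on `z`. If each of the finitely many candidates failed for
    -- some `z`, a generic `z` would defeat all of them at once.
    obtain ⟨I, hiI, hjI, hI⟩ : ∃ I : Finset (Fin k), i ∈ I ∧ j ∉ I ∧ ∀ z, ∀ x y : ∀ i, ι i → E,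
        F (J'.piecewise x (Function.update v l z)) * F (J'.piecewise y (Function.update v l z)) =
          F (J'.piecewise (I.piecewise x y) (Function.update v l z)) *
            F (J'.piecewise (I.piecewise y x) (Function.update v l z)) := by
      by_contra! hcon
      have hpoly : ∀ x : ∀ i, ι i → E, ∃ P : MvPolynomial (ι l) E, ∀ z,
          MvPolynomial.eval z P = F (J'.piecewise x (Function.update v l z)) := fun x => by
        obtain ⟨P, hP⟩ := exists_mvPolynomial_eval_eq (F.toLinearMap (J'.piecewise x v) l)
        exact ⟨P, fun z => by rw [hP, hup]; rfl⟩
      choose P hP using hpoly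
      choose! z₀ x₀ y₀ h₀ using hcon
      obtain ⟨z, hz⟩ := exists_forall_eval_ne_zero
        (Finset.univ.filter fun I : Finset (Fin k) => i ∈ I ∧ j ∉ I)
        (fun I => P (x₀ I) * P (y₀ I) -
          P (I.piecewise (x₀ I) (y₀ I)) * P (I.piecewise (y₀ I) (x₀ I)))
        (fun I hI => ⟨z₀ I, by
          obtain ⟨h1, h2⟩ := (Finset.mem_filter.1 hI).2
          simp only [map_sub, map_mul, hP]
          exact sub_ne_zero.2 (h₀ I h1 h2)⟩)
      obtain ⟨I, h1, h2, h3⟩ := ih ⟨hiJ.2, hjJ.2⟩ (Function.update v l z)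
      refine hz I (by simp [h1, h2]) ?_
      simp only [map_sub, map_mul, hP]
      exact sub_eq_zero.2 (h3 _ _)
    -- we may assume that `l ∉ I`
    wlog hlI : l ∉ I generalizing I
    · refine this (I.erase l) (by simp [hiI, hiJ.1]) (by simp [hjI]) (fun z x y => ?_) (by simp)
      have e : ∀ x y : ∀ i, ι i → E, J'.piecewise ((I.erase l).piecewise x y)
          (Function.update v l z) = J'.piecewise (I.piecewise x y) (Function.update v l z) := by
        intro x y
        ext q : 1
        by_cases hq : q ∈ J'
        · have : q ≠ l := fun h => hlJ' (h ▸ hq)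
          simp [hq, Finset.piecewise, this]
        · simp [hq]
      rw [e, e, hI z x y]
    -- Rows are the arguments in `I`, columns the other free ones, and `z` is the argument in slot
    -- `l`. A common row space puts `l` on the side of `I`, a common column space on the other side.
    have hmin := minors_of_additive_family
      (fun z (x y : ∀ i, ι i → E) => F (J'.piecewise (I.piecewise x y) (Function.update v l z)))
      (fun z z' x y => by simp only [hup, F.map_update_add])
      (fun z x x' y y' => by
        have e : ∀ x y x' y' : ∀ i, ι i → E,
            I.piecewise (I.piecewise x y) (I.piecewise x' y') = I.piecewise x y' := fun x y x' y' => by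
          ext q : 1
          by_cases hq : q ∈ I <;> simp [hq]
        have := hI z (I.piecewise x y) (I.piecewise x' y')
        rwa [e, e] at this)
    have hins2 : ∀ x : ∀ i, ι i → E,
        (insert l J').piecewise x v = J'.piecewise x (Function.update v l (x l)) := fun x => by
      rw [hup, Finset.piecewise_insert]
    have hself : ∀ x : ∀ i, ι i → E, I.piecewise x x = x := fun x => Finset.piecewise_same I x
    rcases hmin with hmin | hmin
    · refine ⟨insert l I, by simp [hiI], by simp [hjI, hjJ.1], fun x y => ?_⟩
      have e : ∀ x y : ∀ i, ι i → E, F ((insert l J').piecewise ((insert l I).piecewise x y) v) =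
          F (J'.piecewise (I.piecewise x y) (Function.update v l (x l))) := fun x y => by
        rw [hins2]
        congr 1
        ext q : 1
        by_cases hq : q ∈ J'
        · have : q ≠ l := fun h => hlJ' (h ▸ hq)
          simp [hq, Finset.piecewise, this]
        · simp [hq]
      rw [e, e, hins2, hins2]
      simpa only [hself] using hmin (x l) (y l) x y x y
    · refine ⟨I, hiI, hjI, fun x y => ?_⟩
      have e : ∀ x y : ∀ i, ι i → E, F ((insert l J').piecewise (I.piecewise x y) v) =
          F (J'.piecewise (I.piecewise x y) (Function.update v l (y l))) := fun x y => by
        rw [hins2, Finset.piecewise_eq_of_notMem _ _ _ hlI]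
      rw [e, e, hins2, hins2, mul_comm (F (J'.piecewise (I.piecewise x y) _))]
      simpa only [hself] using hmin (x l) (y l) x y x y

end Generic

/-! ### Smooth zeros of forms that do not factor -/

section GenericPoint

variable {E : Type*} [Field E] {k : ℕ} {ι : Fin k → Type*} [∀ i, Fintype (ι i)]

theorem exists_minor_ne_zero [Infinite E] {f : (∀ i, ι i) → E}
    (hf : ∀ I : Finset (Fin k), I ≠ ∅ → I ≠ Finset.univ → ¬ FactorsAlong f I)
    {i j : Fin k} (hij : i ≠ j) :
    ∃ v x x' y y',
      form f (Function.update (Function.update v i x) j y) *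
        form f (Function.update (Function.update v i x') j y') ≠
      form f (Function.update (Function.update v i x) j y') *
        form f (Function.update (Function.update v i x') j y) := by
  classical
  by_contra! hcon
  obtain ⟨I, hi, hj, hI⟩ := exists_factors_of_minors (form f) hij hcon
    ((Finset.univ.erase i).erase j) (by simp) 0
  have huniv : ∀ x : ∀ i, ι i → E,
      (insert i (insert j ((Finset.univ.erase i).erase j))).piecewise x 0 = x := fun x => by
    ext l : 1
    refine Finset.piecewise_eq_of_mem _ _ _ ?_
    by_cases hl : l = i <;> by_cases hl' : l = j <;> simp [hl, hl']
  simp only [huniv] at hI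
  refine hf I (Finset.ne_empty_of_mem hi) (fun h => hj (h ▸ Finset.mem_univ j)) fun a a' => ?_
  have e : ∀ a a' : ∀ i, ι i, I.piecewise (fun i => (Pi.single (a i) 1 : ι i → E))
      (fun i => Pi.single (a' i) 1) = fun i => Pi.single (I.piecewise a a' i) 1 := fun a a' => by
    ext l : 1
    by_cases hl : l ∈ I <;> simp [hl]
  have := hI (fun i => Pi.single (a i) 1) (fun i => Pi.single (a' i) 1)
  simpa only [e, form_single] using this

theorem exists_mvPolynomial_eval_form {σ : Type*} (f : (∀ i, ι i) → E)
    (q : ∀ i, ι i → MvPolynomial σ E) :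
    ∃ P : MvPolynomial σ E, ∀ s, MvPolynomial.eval s P =
      form f fun i a => MvPolynomial.eval s (q i a) :=
  ⟨form (fun a => MvPolynomial.C (f a)) q, fun s => by simp [map_form]⟩

/-- A multilinear form that does not factor has a zero at which none of the partial differentials
vanishes. -/
theorem exists_smooth_zero [Infinite E] (hk : 2 ≤ k) {f : (∀ i, ι i) → E}
    (hf : ∀ I : Finset (Fin k), I ≠ ∅ → I ≠ Finset.univ → ¬ FactorsAlong f I) :
    ∃ v w : ∀ i, ι i → E, form f v = 0 ∧ ∀ i, form f (Function.update v i (w i)) = 1 := by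
  classical
  let j : Fin k := ⟨0, by omega⟩
  let i₁ : Fin k := ⟨1, by omega⟩
  have hi₁ : i₁ ≠ j := by simp [i₁, j]
  suffices h : ∃ v : ∀ i, ι i → E, form f v = 0 ∧
      ∀ i, ∃ w, form f (Function.update v i w) ≠ 0 by
    obtain ⟨v, hv, hw⟩ := h
    choose w hw using hw
    refine ⟨v, fun i => (form f (Function.update v i (w i)))⁻¹ • w i, hv, fun i => ?_⟩
    rw [MultilinearMap.map_update_smul, smul_eq_mul, inv_mul_cancel₀ (hw i)]
  -- a common point at which suitable minors do not vanish
  obtain ⟨v, hv⟩ : ∃ v : ∀ i, ι i → E, ∀ i, i ≠ j → ∃ x y y',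
      form f (Function.update (Function.update v i x) j y) * form f (Function.update v j y') -
        form f (Function.update (Function.update v i x) j y') *
          form f (Function.update v j y) ≠ 0 := by
    have h1 : ∀ i, i ≠ j → ∃ v x y y',
        form f (Function.update (Function.update v i x) j y) * form f (Function.update v j y') -
          form f (Function.update (Function.update v i x) j y') *
            form f (Function.update v j y) ≠ 0 := fun i hi => by
      obtain ⟨v, x, x', y, y', h⟩ := exists_minor_ne_zero hf hi
      refine ⟨Function.update v i x', x, y, y', ?_⟩
      rw [Function.update_idem]
      exact sub_ne_zero.2 h
    choose! v₀ x y y' h₀ using h1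
    let X : ∀ i, ι i → MvPolynomial (Σ i, ι i) E := fun i a => MvPolynomial.X ⟨i, a⟩
    have hpt : ∀ (s : (Σ i, ι i) → E) i (z : ι i → E) (q : ∀ i, ι i → MvPolynomial (Σ i, ι i) E),
        (fun l a => MvPolynomial.eval s
          (Function.update q i (fun a => MvPolynomial.C (z a)) l a)) =
        Function.update (fun l a => MvPolynomial.eval s (q l a)) i z := by
      intro s i z q
      ext l a
      by_cases hl : l = i
      · subst hl; simp
      · simp [hl]
    choose P hP using fun q => exists_mvPolynomial_eval_form (σ := Σ i, ι i) f q
    let C : ∀ i, (ι i → E) → ι i → MvPolynomial (Σ i, ι i) E := fun i z a => MvPolynomial.C (z a)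
    have hX : ∀ s : (Σ i, ι i) → E, (fun l a => MvPolynomial.eval s (X l a)) =
        fun l a => s ⟨l, a⟩ := fun s => by simp [X]
    obtain ⟨s, hs⟩ := exists_forall_eval_ne_zero (Finset.univ.filter fun i : Fin k => i ≠ j)
      (fun i => P (Function.update (Function.update X i (C i (x i))) j (C j (y i))) *
          P (Function.update X j (C j (y' i))) -
        P (Function.update (Function.update X i (C i (x i))) j (C j (y' i))) *
          P (Function.update X j (C j (y i))))
      (fun i hi => ⟨fun p => v₀ i p.1 p.2, by
        simp only [map_sub, map_mul, hP, C, hpt, hX]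
        exact h₀ i (Finset.mem_filter.1 hi).2⟩)
    refine ⟨fun l a => s ⟨l, a⟩, fun i hi => ⟨x i, y i, y' i, ?_⟩⟩
    have := hs i (by simp [hi])
    simpa only [map_sub, map_mul, hP, C, hpt, hX] using this
  choose! x y y' hxy using hv
  let φ : (ι j → E) →ₗ[E] E := (form f).toLinearMap v j
  let ψ : Fin k → (ι j → E) →ₗ[E] E := fun i => (form f).toLinearMap (Function.update v i (x i)) j
  -- The nonzero minor says that `φ` and `ψ i` are independent, and `Y i` is a vector killed by `φ`
  -- but not by `ψ i`. A generic combination of the `Y l` works for all `i` at once.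
  let Y : Fin k → ι j → E := fun i => φ (y' i) • y i - φ (y i) • y' i
  have hφY : ∀ i, φ (Y i) = 0 := fun i => by
    simp only [Y, map_sub, map_smul, smul_eq_mul]
    ring
  have hψY : ∀ i, i ≠ j → ψ i (Y i) ≠ 0 := fun i hi => by
    simp only [Y, map_sub, map_smul, smul_eq_mul]
    have := hxy i hi
    simp only [φ, ψ, MultilinearMap.toLinearMap_apply]
    intro h
    refine this ?_
    linear_combination h
  obtain ⟨s, hs⟩ := exists_forall_eval_ne_zero (Finset.univ.filter fun i : Fin k => i ≠ j)
    (fun i => ∑ l : Fin k, MvPolynomial.C (ψ i (Y l)) * MvPolynomial.X l)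
    (fun i hi => ⟨Pi.single i 1, by
      simpa [Pi.single_apply] using hψY i (Finset.mem_filter.1 hi).2⟩)
  have hz0 : form f (Function.update v j (∑ l, s l • Y l)) = 0 := by
    change φ (∑ l, s l • Y l) = 0
    simp [hφY]
  refine ⟨Function.update v j (∑ l, s l • Y l), hz0, fun i => ?_⟩
  by_cases hi : i = j
  · subst hi
    simp only [Function.update_idem]
    -- In slot `j` itself: if `φ` vanished identically, so would the minor for `i₁`. A second slot
    -- is needed here.
    by_contra! hcon
    refine hxy i₁ hi₁ ?_
    rw [hcon, hcon, mul_zero, mul_zero, sub_zero]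
  · refine ⟨x i, ?_⟩
    rw [Function.update_comm (Ne.symm hi)]
    have h1 := hs i (by simp [hi])
    simp only [map_sum, map_mul, MvPolynomial.eval_C, MvPolynomial.eval_X] at h1
    have h2 : ψ i (∑ l, s l • Y l) = ∑ l, ψ i (Y l) * s l := by
      simp [mul_comm]
    rw [← h2] at h1
    exact h1

end GenericPoint

/-! ### Partition rank one, factoring and Kronecker powers -/

section PartitionRankOne

variable {K : Type*} [Field K] {k : ℕ} {n m : Fin k → ℕ}

theorem HasPartitionRankOne.splits {T : Tensor K n} (hT : HasPartitionRankOne T) :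
    Splits (coeff T : (∀ i, Fin (n i)) → K) := by
  classical
  obtain ⟨I, h1, h2, hI⟩ := hT
  rw [Matrix.rank_eq_finrank_span_cols] at hI
  obtain ⟨v, hv⟩ := finrank_le_one_iff.1 hI.le
  have hc : ∀ b, ∃ c : K, ∀ a, flattening T I a b = c * v.1 a := fun b => by
    obtain ⟨c, hc⟩ := hv ⟨(flattening T I).col b, Submodule.subset_span ⟨b, rfl⟩⟩
    refine ⟨c, fun a => ?_⟩
    have := congrFun (congrArg Subtype.val hc) a
    exact this.symm
  choose c hc using hc
  refine ⟨I, Finset.nonempty_iff_ne_empty.2 h1, ?_, fun a => v.1 fun i => a i,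
    fun a => c fun i => a i, fun a b h => ?_, fun a b h => ?_, ?_⟩
  · rw [← Finset.coe_compl]
    exact Finset.nonempty_iff_ne_empty.2 fun h => h2 (Finset.compl_eq_empty_iff I |>.1 h)
  · exact congrArg _ (funext fun i : {i // i ∈ I} => h i i.2)
  · exact congrArg _ (funext fun i : {i // i ∉ I} => h i i.2)
  · ext a
    have := hc (fun i => a i) (fun i => a i)
    rw [Pi.mul_apply, mul_comm, ← this]
    simp [flattening]

theorem FactorsAlong.hasPartitionRankOne {T : Tensor K n} (hT : T ≠ 0) {I : Finset (Fin k)}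
    (h1 : I ≠ ∅) (h2 : I ≠ Finset.univ) (hI : FactorsAlong (coeff T) I) :
    HasPartitionRankOne T := by
  classical
  refine ⟨I, h1, h2, ?_⟩
  have hT' : coeff T ≠ 0 := fun h => hT (by simpa using h)
  obtain ⟨a₀, h0⟩ := Function.ne_iff.1 hT'
  have h0 : coeff T a₀ ≠ 0 := h0
  have hle : (flattening T I).rank ≤ 1 := by
    have : flattening T I = Matrix.vecMulVec
        (fun a => coeff T fun i => if h : i ∈ I then a ⟨i, h⟩ else a₀ i)
        (fun b => coeff T (fun i => if h : i ∈ I then a₀ i else b ⟨i, h⟩) / coeff T a₀) := by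
      ext a b
      have := hI (fun i => if h : i ∈ I then a ⟨i, h⟩ else b ⟨i, h⟩) a₀
      simp only [flattening, Matrix.of_apply, Matrix.vecMulVec_apply]
      rw [← mul_div_assoc, eq_div_iff h0, this]
      refine congrArg₂ (· * ·) (congrArg _ (funext fun i => ?_)) (congrArg _ (funext fun i => ?_))
      · by_cases hi : i ∈ I <;> simp [hi]
      · by_cases hi : i ∈ I <;> simp [hi]
    rw [this]
    exact Matrix.rank_vecMulVec_le _ _
  have hne : (flattening T I).rank ≠ 0 := fun h => by
    rw [Matrix.rank_eq_finrank_span_cols, Submodule.finrank_eq_zero, Submodule.span_eq_bot] at h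
    have := congrFun (h _ ⟨fun i => a₀ i, rfl⟩) fun i => a₀ i
    refine h0 (Eq.trans ?_ this)
    simp [flattening]
  omega

theorem factorsAlong_single (a₀ : ∀ i, Fin (n i)) (c : K) (I : Finset (Fin k)) :
    FactorsAlong (fun a => if a = a₀ then c else 0) I := by
  classical
  intro a a'
  have e : (I.piecewise a a' = a₀ ∧ I.piecewise a' a = a₀) ↔ (a = a₀ ∧ a' = a₀) := by
    constructor
    · rintro ⟨h1, h2⟩
      constructor
      · ext i : 1
        by_cases hi : i ∈ I
        · simpa [hi] using congrFun h1 i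
        · simpa [hi] using congrFun h2 i
      · ext i : 1
        by_cases hi : i ∈ I
        · simpa [hi] using congrFun h2 i
        · simpa [hi] using congrFun h1 i
    · rintro ⟨rfl, rfl⟩
      exact ⟨Finset.piecewise_same _ _, Finset.piecewise_same _ _⟩
  simp only [ite_mul, mul_ite, zero_mul, mul_zero, ← ite_and]
  simp only [and_comm] at e ⊢
  simp only [e]

/-- Each nonzero coefficient gives an elementary tensor. Hence the infimum in `partitionRank` is
attained and is not the default value `sInf ∅ = 0`. -/
theorem exists_sum_hasPartitionRankOne (hk : 2 ≤ k) (T : Tensor K n) :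
    ∃ r : ℕ, ∃ S : Fin r → Tensor K n, (∀ j, HasPartitionRankOne (S j)) ∧ T = ∑ j, S j := by
  classical
  let s : Finset (∀ i, Fin (n i)) := Finset.univ.filter fun a => coeff T a ≠ 0
  let U : (∀ i, Fin (n i)) → Tensor K n := fun a₀ =>
    coeff.symm fun a => if a = a₀ then coeff T a₀ else 0
  have hU : ∀ a ∈ s, HasPartitionRankOne (U a) := fun a ha => by
    have ha' : coeff T a ≠ 0 := (Finset.mem_filter.1 ha).2
    refine FactorsAlong.hasPartitionRankOne (I := {⟨0, by omega⟩}) (fun h => ha' ?_)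
      (Finset.singleton_ne_empty _) (fun h => ?_) ?_
    · have := congrFun (congrArg coeff h) a
      simpa [U] using this
    · have := h ▸ Finset.mem_univ (⟨1, by omega⟩ : Fin k)
      simp at this
    · simp only [U, LinearEquiv.apply_symm_apply]
      exact factorsAlong_single _ _ _
  refine ⟨s.card, fun j => U (s.equivFin.symm j).1, fun j => hU _ (s.equivFin.symm j).2, ?_⟩
  rw [s.equivFin.symm.sum_comp (fun a => U a.1), Finset.sum_coe_sort s U]
  apply coeff.injective
  ext a
  rw [map_sum, Finset.sum_apply]
  simp only [U, LinearEquiv.apply_symm_apply, Finset.sum_ite_eq]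
  by_cases h : coeff T a = 0 <;> simp [s, h]

theorem hasPartitionRankLE_partitionRank (hk : 2 ≤ k) (T : Tensor K n) :
    HasPartitionRankLE (partitionRank T) (coeff T : (∀ i, Fin (n i)) → K) := by
  obtain ⟨S, hS, hT⟩ := Nat.sInf_mem (exists_sum_hasPartitionRankOne hk T)
  refine ⟨fun l => coeff (S l), fun l => Or.inr (hS l).splits, ?_⟩
  conv_lhs => rw [hT, map_sum]
  rfl

theorem HasPartitionRankOne.partitionRank_eq_one {T : Tensor K n} (hT : HasPartitionRankOne T)
    (h0 : T ≠ 0) : partitionRank T = 1 := by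
  have h1 : 1 ∈ {r : ℕ | ∃ S : Fin r → Tensor K n, (∀ j, HasPartitionRankOne (S j)) ∧
      T = ∑ j, S j} := ⟨fun _ => T, fun _ => hT, by simp⟩
  refine le_antisymm (Nat.sInf_le h1) (Nat.one_le_iff_ne_zero.2 fun h => h0 ?_)
  have h2 := Nat.sInf_mem ⟨1, h1⟩
  change partitionRank T ∈ _ at h2
  rw [h] at h2
  obtain ⟨S, -, hS⟩ := h2
  simpa using hS

theorem coeff_kron (T : Tensor K n) (S : Tensor K m) (c : ∀ i, Fin (n i * m i)) :
    coeff (kron T S) c = coeff T (fun i => (finProdFinEquiv.symm (c i)).1) *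
      coeff S (fun i => (finProdFinEquiv.symm (c i)).2) := by
  rw [kron, LinearEquiv.apply_symm_apply]

theorem FactorsAlong.kron {T : Tensor K n} {S : Tensor K m} {I : Finset (Fin k)}
    (hT : FactorsAlong (coeff T) I) (hS : FactorsAlong (coeff S) I) :
    FactorsAlong (coeff (kron T S)) I := by
  intro a a'
  have e1 : ∀ a a' : ∀ i, Fin (n i * m i), (fun i => (finProdFinEquiv.symm (I.piecewise a a' i)).1) =
      I.piecewise (fun i => (finProdFinEquiv.symm (a i)).1)
        fun i => (finProdFinEquiv.symm (a' i)).1 := fun a a' => by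
    ext i : 1
    by_cases hi : i ∈ I <;> simp [hi]
  have e2 : ∀ a a' : ∀ i, Fin (n i * m i), (fun i => (finProdFinEquiv.symm (I.piecewise a a' i)).2) =
      I.piecewise (fun i => (finProdFinEquiv.symm (a i)).2)
        fun i => (finProdFinEquiv.symm (a' i)).2 := fun a a' => by
    ext i : 1
    by_cases hi : i ∈ I <;> simp [hi]
  simp only [coeff_kron, e1, e2]
  have h1 := hT (fun i => (finProdFinEquiv.symm (a i)).1) fun i => (finProdFinEquiv.symm (a' i)).1
  have h2 := hS (fun i => (finProdFinEquiv.symm (a i)).2) fun i => (finProdFinEquiv.symm (a' i)).2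
  rw [mul_mul_mul_comm, h1, h2, mul_mul_mul_comm]

theorem FactorsAlong.kronPow {T : Tensor K n} {I : Finset (Fin k)}
    (hT : FactorsAlong (coeff T) I) (N : ℕ) : FactorsAlong (coeff (kronPow T N)) I := by
  induction N with
  | zero =>
    intro a a'
    simp only [PartitionRankGap.kronPow, LinearEquiv.apply_symm_apply]
  | succ N ih => exact ih.kron hT

theorem kron_ne_zero {T : Tensor K n} {S : Tensor K m} (hT : T ≠ 0) (hS : S ≠ 0) :
    kron T S ≠ 0 := by
  have hT' : coeff T ≠ 0 := fun h => hT (by simpa using h)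
  have hS' : coeff S ≠ 0 := fun h => hS (by simpa using h)
  obtain ⟨a, ha⟩ := Function.ne_iff.1 hT'
  obtain ⟨b, hb⟩ := Function.ne_iff.1 hS'
  intro h
  have := coeff_kron T S fun i => finProdFinEquiv (a i, b i)
  simp only [h, Equiv.symm_apply_apply, map_zero, Pi.zero_apply] at this
  exact mul_ne_zero ha hb this.symm

theorem coeff_kronPow_zero (T : Tensor K n) : coeff (kronPow T 0) = fun _ => 1 :=
  LinearEquiv.apply_symm_apply _ _

theorem kronPow_ne_zero {T : Tensor K n} (hT : T ≠ 0) (N : ℕ) : kronPow T N ≠ 0 := by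
  induction N with
  | zero =>
    intro h
    have := congrFun (coeff_kronPow_zero T) fun i => ⟨0, by simp⟩
    rw [h, map_zero] at this
    exact zero_ne_one this
  | succ N ih => exact kron_ne_zero ih hT

end PartitionRankOne

/-! ### Evaluating powers at product vectors -/

section Evaluation

variable {K : Type*} [Field K] {k : ℕ} {n m : Fin k → ℕ} {E : Type*} [Field E] (σ : K →+* E)

theorem form_kron (T : Tensor K n) (S : Tensor K m) (x : ∀ i, Fin (n i) → E)
    (y : ∀ i, Fin (m i) → E) :
    form (fun c => σ (coeff (kron T S) c)) (fun i c =>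
      x i (finProdFinEquiv.symm c).1 * y i (finProdFinEquiv.symm c).2) =
    form (fun a => σ (coeff T a)) x * form (fun b => σ (coeff S b)) y := by
  let e : (∀ i, Fin (n i * m i)) ≃ (∀ i, Fin (n i)) × (∀ i, Fin (m i)) :=
    { toFun := fun c =>
        (fun i => (finProdFinEquiv.symm (c i)).1, fun i => (finProdFinEquiv.symm (c i)).2)
      invFun := fun p i => finProdFinEquiv (p.1 i, p.2 i)
      left_inv := fun c => funext fun i => finProdFinEquiv.apply_symm_apply (c i)
      right_inv := fun p => by simp }
  rw [form_apply, form_apply, form_apply, Fintype.sum_mul_sum, ← Fintype.sum_prod_type',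
    ← e.sum_comp]
  refine Finset.sum_congr rfl fun c _ => ?_
  rw [coeff_kron, map_mul, Finset.prod_mul_distrib, mul_mul_mul_comm]
  rfl

/-- The coordinates of `z 0 ⊗ ⋯ ⊗ z (N - 1)`. -/
def tensorVec {d : ℕ} (z : ℕ → Fin d → E) : (N : ℕ) → Fin (d ^ N) → E
  | 0 => fun _ => 1
  | N + 1 => fun c => tensorVec z N (finProdFinEquiv.symm (c : Fin (d ^ N * d))).1 *
      z N (finProdFinEquiv.symm (c : Fin (d ^ N * d))).2

theorem form_kronPow (T : Tensor K n) (z : ∀ i, ℕ → Fin (n i) → E) (N : ℕ) :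
    form (fun c => σ (coeff (kronPow T N) c)) (fun i => tensorVec (z i) N) =
      ∏ s ∈ Finset.range N, form (fun a => σ (coeff T a)) fun i => z i s := by
  induction N with
  | zero =>
    rw [form_apply, Finset.range_zero, Finset.prod_empty]
    have h : ∀ c, coeff (kronPow T 0) c = 1 := fun c => by rw [coeff_kronPow_zero]
    simp only [h, tensorVec, map_one, Finset.prod_const_one, mul_one, Finset.sum_const]
    rw [Finset.card_univ, Fintype.card_pi]
    simp
  | succ N ih =>
    rw [Finset.prod_range_succ, ← ih, ← form_kron]
    rfl

end Evaluation

/-! ### Restricting a Kronecker power to a partition tensor -/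

section Lower

/-- The product over all positions of a multilinear form, evaluated at `w i` in the positions in
`B i` and at `v i` in the remaining positions, is the indicator of `B` being a partition. -/
theorem prod_form_eq_one {E : Type*} [Field E] {k N : ℕ} {ι : Fin k → Type*} [∀ i, Fintype (ι i)]
    {f : (∀ i, ι i) → E} {v w : ∀ i, ι i → E}
    (hw : ∀ i, form f (Function.update v i (w i)) = 1) {B : Fin k → Finset (Fin N)}
    (hB : ∀ s, ∃! i, s ∈ B i) :
    ∏ s, form f (fun i => if s ∈ B i then w i else v i) = 1 := by
  refine Finset.prod_eq_one fun s _ => ?_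
  obtain ⟨i, hi, huniq⟩ := hB s
  rw [← hw i]
  congr 1
  ext1 l
  by_cases hl : l = i
  · subst hl
    simp [hi]
  · have : s ∉ B l := fun h => hl (huniq l h)
    simp [hl, this]

theorem exists_mem_of_sum_val {α : Type*} {k : ℕ} {A : Fin k → Finset α} {W : Finset α}
    (h : ∑ i, (A i).val = W.val) {s : α} (hs : s ∈ W) : ∃! i, s ∈ A i := by
  classical
  have h1 : ∑ i, (if s ∈ A i then 1 else 0) = 1 := by
    have h2 := congrArg (Multiset.count s) h
    rw [Multiset.count_sum', Multiset.count_eq_one_of_mem W.nodup hs] at h2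
    refine Eq.trans ?_ h2
    refine Finset.sum_congr rfl fun i _ => ?_
    rw [Multiset.count_eq_of_nodup (A i).nodup]
    rfl
  rw [← Finset.card_filter, Finset.card_eq_one] at h1
  obtain ⟨i, hi⟩ := h1
  refine ⟨i, ?_, fun l hl => ?_⟩
  · have : i ∈ Finset.univ.filter fun i => s ∈ A i := hi ▸ Finset.mem_singleton_self i
    simpa using this
  · have : l ∈ Finset.univ.filter fun i => s ∈ A i := by simp [hl]
    rw [hi] at this
    simpa using this

theorem sum_val_eq_of_cover {α : Type*} [DecidableEq α] {k m : ℕ} {A : Fin k → Finset α}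
    {W : Finset α} (hA : ∀ i, (A i).card = m) (hW : W.card = k * m)
    (h : ∀ s ∈ W, ∃ i, s ∈ A i) : ∑ i, (A i).val = W.val := by
  refine (Multiset.eq_of_le_of_card_le ?_ ?_).symm
  · rw [Finset.val_le_iff_val_subset]
    intro s hs
    obtain ⟨i, hi⟩ := h s hs
    exact Multiset.mem_sum.2 ⟨i, Finset.mem_univ i, hi⟩
  · rw [Multiset.card_sum]
    simp [hA, hW]

/-- The lower bound for the partition rank of the Kronecker powers of a tensor that does not
factor. -/
theorem exists_const_mul_choose_lt_partitionRank {K : Type*} [Field K] {k : ℕ} (hk : 2 ≤ k)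
    {n : Fin k → ℕ} {T : Tensor K n} (hT : T ≠ 0)
    (hf : ∀ I : Finset (Fin k), I ≠ ∅ → I ≠ Finset.univ → ¬ FactorsAlong (coeff T) I) :
    ∃ c : ℝ, 0 < c ∧ ∀ N : ℕ,
      c * (k * (N / k)).choose (N / k) < (partitionRank (kronPow T N) : ℝ) := by
  classical
  obtain ⟨j, rfl⟩ : ∃ j, k = j + 1 := ⟨k - 1, by omega⟩
  let E := HahnSeries ℚ K
  let σ : K →+* E := HahnSeries.C
  have hσ : Function.Injective σ := σ.injective
  obtain ⟨v, w, hv, hw⟩ := exists_smooth_zero (E := E) hk (f := fun a => σ (coeff T a))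
    fun I h1 h2 h => hf I h1 h2 fun a a' => hσ (by simpa using h a a')
  obtain ⟨δ, hδ, c, hc, hmain⟩ := IsPartitionSum.exists_lt_of_hasPartitionRankLE
    (isFineScaling_hahnValuation K) j
  refine ⟨c, hc, fun N => ?_⟩
  set m := N / (j + 1) with hm
  have hmN : (j + 1) * m ≤ N := Nat.mul_div_le N (j + 1)
  have hne : ∀ i, Nonempty (Fin (n i ^ N)) := by
    have hT' : coeff T ≠ 0 := fun h => hT (by simpa using h)
    obtain ⟨a, -⟩ := Function.ne_iff.1 hT'
    exact fun i => ⟨⟨0, pow_pos (Fin.pos (a i)) N⟩⟩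
  let W : Finset (Fin N) := Finset.univ.map (Fin.castLEEmb hmN)
  have hWc : W.card = (j + 1) * m := by simp [W]
  -- Fewer than `k` positions lie outside `W`. Assigning them always to slot 0 makes their factors
  -- equal to 1.
  let B : Fin (j + 1) → Finset (Fin N) → Finset (Fin N) := fun i A => if i = 0 then A ∪ Wᶜ else A
  let z : ∀ i, Finset (Fin N) → ℕ → Fin (n i) → E := fun i A s =>
    if h : s < N then (if (⟨s, h⟩ : Fin N) ∈ B i A then w i else v i) else v i
  let g : (Fin (j + 1) → Finset (Fin N)) → E := fun A =>
    ∏ s : Fin N, form (fun a => σ (coeff T a)) fun i => if s ∈ B i (A i) then w i else v i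
  have hg : HasPartitionRankLE (partitionRank (kronPow T N)) g := by
    have h1 := ((hasPartitionRankLE_partitionRank hk (kronPow T N)).map σ).pullback
      (κ := fun _ => Finset (Fin N)) fun i A => tensorVec (z i A) N
    convert h1 using 2 with A
    rw [← form_apply, form_kronPow, Finset.prod_range]
    refine Finset.prod_congr rfl fun s _ => ?_
    congr 1
    ext1 i
    simp [z]
  have hBW : ∀ i A s, s ∈ W → (s ∈ B i A ↔ s ∈ A) := fun i A s hs => by
    simp only [B]
    split_ifs <;> simp [hs]
  have hone : ∀ A : Fin (j + 1) → Finset (Fin N), (∀ i, A i ∈ W.powersetCard m) →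
      ∑ i, (A i).val = W.val → g A = 1 := fun A hA hsum => by
    refine prod_form_eq_one hw fun s => ?_
    by_cases hs : s ∈ W
    · simpa only [hBW _ _ s hs] using exists_mem_of_sum_val hsum hs
    · have hsA : ∀ i, s ∉ A i := fun i h => hs ((Finset.mem_powersetCard.1 (hA i)).1 h)
      refine ⟨0, by simp [B, hs], fun i hi => ?_⟩
      by_contra h0
      simp only [B, h0, if_false] at hi
      exact hsA i hi
  have hzero : ∀ A : Fin (j + 1) → Finset (Fin N), (∀ i, A i ∈ W.powersetCard m) →
      ∑ i, (A i).val ≠ W.val → g A = 0 := fun A hA hsum => by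
    obtain ⟨s, hs, hsA⟩ : ∃ s ∈ W, ∀ i, s ∉ A i := by
      by_contra! hcon
      exact hsum (sum_val_eq_of_cover (fun i => (Finset.mem_powersetCard.1 (hA i)).2) hWc hcon)
    refine Finset.prod_eq_zero (Finset.mem_univ s) ?_
    simp only [hBW _ _ s hs, hsA, if_false]
    exact hv
  have hsumW : IsPartitionSum (hahnValuation K) m {()} (fun _ => W)
      (fun _ _ => W.powersetCard m) g := by
    refine ⟨fun _ _ => hWc, fun _ _ _ => subset_rfl, fun _ _ _ _ _ _ _ _ => rfl,
      fun A hA => ?_, fun A hA => ?_⟩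
    · have hA' : ∀ i, A i ∈ W.powersetCard m := fun i => by simpa using hA i
      by_cases hsum : ∑ i, (A i).val = W.val
      · rw [hone A hA' hsum, map_one]
      · rw [hzero A hA' hsum, map_zero]
        exact zero_le
    · have hA' : ∀ i, A i ∈ W.powersetCard m := fun i => by simpa using hA i
      by_cases hsum : ∑ i, (A i).val = W.val
      · rw [hone A hA' hsum, map_one]
        exact iff_of_true rfl ⟨(), by simp, hA', hsum⟩
      · rw [hzero A hA' hsum, map_zero]
        refine iff_of_false zero_ne_one ?_
        rintro ⟨-, -, -, h⟩
        exact hsum h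
  have := hmain N m Unit {()} (fun _ => W) (fun _ _ => W.powersetCard m) g hsumW (by simp)
    (fun x _ i => by simpa using by positivity) _ hg
  simpa using this

end Lower

/-! ### Binomial asymptotics -/

section Asymptotics

/-- The largest term of the binomial expansion of `(1 + q) ^ ((q + 1) * m)` has index `m`. -/
theorem pow_mul_choose_le (q m i : ℕ) (hi : i ≤ (q + 1) * m) :
    q ^ ((q + 1) * m - i) * ((q + 1) * m).choose i ≤ q ^ (q * m) * ((q + 1) * m).choose m := by
  set n := (q + 1) * m with hn
  have hn' : n = q * m + m := by rw [hn]; ring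
  -- For `q > 0`, the ratio of term `i + 1` to term `i` is `(n - i) / ((i + 1) * q)`: at least 1 for
  -- `i < m`, at most 1 for `i ≥ m`.
  have hstep : ∀ i, i < n → (i + 1) * (q ^ (n - (i + 1)) * n.choose (i + 1)) =
      (n - i) * (q ^ (n - (i + 1)) * n.choose i) := fun i _ => by
    have := Nat.choose_succ_right_eq n i
    calc _ = q ^ (n - (i + 1)) * (n.choose (i + 1) * (i + 1)) := by ring
      _ = _ := by rw [this]; ring
  have hpow : ∀ i, i < n → q ^ (n - i) = q * q ^ (n - (i + 1)) := fun i hi => by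
    rw [← pow_succ']
    congr 1
    omega
  have hm : q ^ (q * m) * n.choose m = q ^ (n - m) * n.choose m := by
    congr 2
    omega
  rw [hm]
  rcases le_total i m with him | him
  · induction him using Nat.decreasingInduction with
    | self => exact le_rfl
    | of_succ i hi' ih =>
      have hin : i < n := by
        have : m ≤ n := by omega
        omega
      refine le_trans ?_ (ih (by omega))
      refine Nat.le_of_mul_le_mul_left ?_ (Nat.succ_pos i)
      rw [Nat.succ_eq_add_one, hstep i hin, hpow i hin]
      have h1 : (i + 1) * q ≤ n - i := by
        have : (i + 1) * q ≤ m * q := Nat.mul_le_mul_right q hi'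
        rw [mul_comm m q] at this
        omega
      calc _ = ((i + 1) * q) * (q ^ (n - (i + 1)) * n.choose i) := by ring
        _ ≤ _ := Nat.mul_le_mul_right _ h1
  · induction i, him using Nat.le_induction with
    | base => exact le_rfl
    | succ i hmi ih =>
      have hin : i < n := by omega
      refine le_trans ?_ (ih (by omega))
      refine Nat.le_of_mul_le_mul_left ?_ (Nat.succ_pos i)
      rw [Nat.succ_eq_add_one, hstep i hin, hpow i hin]
      have h1 : n - i ≤ (i + 1) * q := by
        have : m * q ≤ (i + 1) * q := Nat.mul_le_mul_right q (by omega)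
        rw [mul_comm m q] at this
        omega
      calc _ ≤ ((i + 1) * q) * (q ^ (n - (i + 1)) * n.choose i) := Nat.mul_le_mul_right _ h1
        _ = _ := by ring

/-- The binomial expansion of `(1 + q) ^ n` has `n + 1` terms, none larger than the one of index
`m`. -/
theorem succ_pow_le_mul_choose (q m : ℕ) :
    (q + 1) ^ ((q + 1) * m) ≤
      ((q + 1) * m + 1) * (q ^ (q * m) * ((q + 1) * m).choose m) := by
  rw [add_comm q 1, add_pow, add_comm 1 q]
  refine (Finset.sum_le_card_nsmul _ _ _ fun i hi => ?_).trans_eq (by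
    rw [Finset.card_range, smul_eq_mul])
  rw [one_pow, one_mul]
  exact pow_mul_choose_le q m i (by simpa [Nat.lt_succ_iff] using hi)

theorem gapConst_pow (q : ℕ) (hq : 1 ≤ q) :
    gapConst (q + 1) ^ (q + 1) = (q + 1 : ℝ) ^ (q + 1) / (q : ℝ) ^ q := by
  have hq0 : (0 : ℝ) ≤ q := by positivity
  rw [gapConst, div_pow]
  push_cast
  rw [add_sub_cancel_right, ← Real.rpow_natCast ((q : ℝ) ^ _), ← Real.rpow_mul hq0]
  push_cast
  rw [div_mul_cancel₀ _ (by positivity), Real.rpow_natCast]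

theorem one_lt_gapConst {k : ℕ} (hk : 2 ≤ k) : 1 < gapConst k := by
  obtain ⟨q, rfl⟩ : ∃ q, k = q + 1 := ⟨k - 1, by omega⟩
  have hq : (1 : ℝ) ≤ q := by exact_mod_cast (by omega : 1 ≤ q)
  rw [gapConst]
  push_cast
  rw [add_sub_cancel_right, one_lt_div (by positivity)]
  calc (q : ℝ) ^ ((q : ℝ) / (q + 1)) ≤ (q : ℝ) ^ (1 : ℝ) :=
        Real.rpow_le_rpow_of_exponent_le hq ((div_le_one (by positivity)).2 (by linarith))
    _ < q + 1 := by rw [Real.rpow_one]; linarith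

theorem gapConst_pow_le_mul_choose {k : ℕ} (hk : 2 ≤ k) (m : ℕ) :
    gapConst k ^ (k * m) ≤ (k * m + 1) * (k * m).choose m := by
  obtain ⟨q, rfl⟩ : ∃ q, k = q + 1 := ⟨k - 1, by omega⟩
  have hq : (0 : ℝ) < q := by exact_mod_cast (by omega : 0 < q)
  rw [pow_mul, gapConst_pow q (by omega), div_pow, ← pow_mul, ← pow_mul,
    div_le_iff₀ (by positivity)]
  have h : (((q + 1) ^ ((q + 1) * m) : ℕ) : ℝ) ≤
      (((q + 1) * m + 1) * (q ^ (q * m) * ((q + 1) * m).choose m) : ℕ) := by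
    exact_mod_cast succ_pow_le_mul_choose q m
  push_cast at h ⊢
  linarith

theorem isLittleO_logb_succ_mul (g a : ℝ) (ha : 0 < a) :
    (fun N : ℕ => Real.logb g ((N + 1) * a)) =o[Filter.atTop] fun N : ℕ => (N : ℝ) := by
  have h1 : (fun N : ℕ => Real.log ((N : ℝ) + 1)) =o[Filter.atTop] fun N : ℕ => (N : ℝ) := by
    have h2 : Filter.Tendsto (fun N : ℕ => (N : ℝ) + 1) Filter.atTop Filter.atTop :=
      Filter.tendsto_atTop_add_const_right _ _ tendsto_natCast_atTop_atTop
    refine (Real.isLittleO_log_id_atTop.comp_tendsto h2).trans_isBigO ?_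
    refine Asymptotics.IsBigO.of_bound 2 ?_
    filter_upwards [Filter.eventually_ge_atTop 1] with N hN
    have : (1 : ℝ) ≤ N := by exact_mod_cast hN
    simp only [Function.comp, id, Real.norm_eq_abs]
    rw [abs_of_nonneg (by positivity), abs_of_nonneg (by positivity)]
    linarith
  have h3 : (fun _ : ℕ => Real.log a) =o[Filter.atTop] fun N : ℕ => (N : ℝ) :=
    (Asymptotics.isLittleO_const_id_atTop _).comp_tendsto tendsto_natCast_atTop_atTop
  have h4 : (fun N : ℕ => Real.logb g ((N + 1) * a)) =
      fun N : ℕ => (Real.log g)⁻¹ * (Real.log ((N : ℝ) + 1) + Real.log a) := by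
    ext N
    rw [Real.logb, Real.log_mul (by positivity) ha.ne', div_eq_inv_mul]
  rw [h4]
  exact (h1.add h3).const_mul_left _

/-- Exponential lower bounds up to polynomial factors, in terms of `gapConst`. -/
theorem exists_isLittleO_of_const_mul_choose_le {k : ℕ} (hk : 2 ≤ k) {P : ℕ → ℝ} {c : ℝ}
    (hc : 0 < c) (hP : ∀ N : ℕ, c * (k * (N / k)).choose (N / k) ≤ P N) :
    ∃ α : ℕ → ℝ, α =o[Filter.atTop] (fun N : ℕ => (N : ℝ)) ∧
      ∀ N : ℕ, gapConst k ^ ((N : ℝ) - α N) ≤ P N := by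
  set g := gapConst k with hg
  have hg1 : 1 < g := one_lt_gapConst hk
  have hg0 : 0 < g := one_pos.trans hg1
  -- The logarithm absorbs the polynomial factor `N + 1`, the constant `c`, and `g ^ k` from
  -- rounding `N` down to a multiple of `k`.
  refine ⟨fun N => Real.logb g ((N + 1) * (g ^ k / c)), isLittleO_logb_succ_mul _ _ (by positivity),
    fun N => ?_⟩
  rw [Real.rpow_sub hg0, Real.rpow_logb hg0 hg1.ne' (by positivity), Real.rpow_natCast]
  refine le_trans ?_ (hP N)
  have h1 := gapConst_pow_le_mul_choose hk (N / k)
  have h2 : N ≤ k * (N / k) + k := by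
    have := Nat.div_add_mod N k
    have := Nat.mod_lt N (by omega : k > 0)
    omega
  have h3 : g ^ N ≤ g ^ (k * (N / k)) * g ^ k := by
    rw [← pow_add]
    exact pow_le_pow_right₀ hg1.le h2
  have h4 : (k * (N / k : ℕ) + 1 : ℝ) ≤ N + 1 := by
    have : k * (N / k) ≤ N := Nat.mul_div_le N k
    exact_mod_cast Nat.succ_le_succ this
  rw [div_le_iff₀ (by positivity)]
  calc g ^ N ≤ g ^ (k * (N / k)) * g ^ k := h3
    _ ≤ ((k * (N / k : ℕ) + 1) * (k * (N / k)).choose (N / k)) * g ^ k := by gcongr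
    _ ≤ ((N + 1) * (k * (N / k)).choose (N / k)) * g ^ k := by gcongr
    _ = _ := by field_simp

end Asymptotics

end PartitionRankGap

theorem mainTheorem8 {K : Type*} [Field K] (k : ℕ) (hk : 2 ≤ k) (n : Fin k → ℕ)
    (T : PartitionRankGap.Tensor K n) (hT : T ≠ 0) :
    ((∀ N : ℕ, PartitionRankGap.partitionRank (PartitionRankGap.kronPow T N) = 1) ∨
      (∃ α : ℕ → ℝ, Asymptotics.IsLittleO Filter.atTop α (fun N : ℕ => (N : ℝ)) ∧
        ∀ N : ℕ, PartitionRankGap.gapConst k ^ ((N : ℝ) - α N) ≤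
          (PartitionRankGap.partitionRank (PartitionRankGap.kronPow T N) : ℝ))) ∧
    ¬ ((∀ N : ℕ, PartitionRankGap.partitionRank (PartitionRankGap.kronPow T N) = 1) ∧
      (∃ α : ℕ → ℝ, Asymptotics.IsLittleO Filter.atTop α (fun N : ℕ => (N : ℝ)) ∧
        ∀ N : ℕ, PartitionRankGap.gapConst k ^ ((N : ℝ) - α N) ≤
          (PartitionRankGap.partitionRank (PartitionRankGap.kronPow T N) : ℝ))) := by
  constructor
  · by_cases hf : ∃ I : Finset (Fin k), I ≠ ∅ ∧ I ≠ Finset.univ ∧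
        PartitionRankGap.FactorsAlong (PartitionRankGap.coeff T) I
    · obtain ⟨I, h1, h2, hI⟩ := hf
      refine Or.inl fun N => ?_
      have h0 := PartitionRankGap.kronPow_ne_zero hT N
      exact ((hI.kronPow N).hasPartitionRankOne h0 h1 h2).partitionRank_eq_one h0
    · push Not at hf
      obtain ⟨c, hc, h⟩ := PartitionRankGap.exists_const_mul_choose_lt_partitionRank hk hT
        fun I h1 h2 h => hf I (Finset.nonempty_iff_ne_empty.2 h1) h2 h
      exact Or.inr
        (PartitionRankGap.exists_isLittleO_of_const_mul_choose_le hk hc fun N => (h N).le)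
  · rintro ⟨h1, α, hα, h2⟩
    -- The base exceeds 1, so rank 1 forces a nonpositive exponent, and `α` cannot be sublinear.
    have hle : ∀ N : ℕ, (N : ℝ) ≤ α N := fun N => by
      by_contra! hcon
      have h3 := h2 N
      rw [h1 N, Nat.cast_one] at h3
      exact absurd (Real.one_lt_rpow (PartitionRankGap.one_lt_gapConst hk) (sub_pos.2 hcon))
        h3.not_gt
    obtain ⟨N, hN, hN1⟩ := ((hα.bound (half_pos one_pos)).and
      (Filter.eventually_ge_atTop 1)).exists
    have h3 : (1 : ℝ) ≤ N := by exact_mod_cast hN1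
    have h4 := hle N
    rw [Real.norm_eq_abs, Real.norm_eq_abs, abs_of_nonneg (by linarith),
      abs_of_nonneg (by linarith)] at hN
    linarith
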